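/- Let $d\ge 3$ and $r\ge 2$ be integers. Let $\Sigma(d,r)$ be the projective space, of dimension $N(d,r)=\binom{d+r}{d}-1$, of hypersurfaces of degree $d$ in $\mathbb P^r$ over $\mathbb C$, i.e. of nonzero homogeneous polynomials of degree $d$ in $x_0,\dots,x_r$ up to nonzero scalars, with its Zariski topology. For such a polynomial $f$ let $$\operatorname{hess}(f)=\det\Big(\frac{\partial^2 f}{\partial x_i\,\partial x_j}\Big)_{0\le i,j\le r},$$ which is zero or homogeneous of degree $(r+1)(d-2)$. The Hessian map $$h_{d,r}\colon \Sigma(d,r)\dashrightarrow \Sigma((r+1)(d-2),r),\qquad [f]\mapsto[\operatorname{hess}(f)],$$ is defined on the set $U$ of all $[f]$ with $\operatorname{hess}(f)\ne 0$. Let the Hessian variety $H_{d,r}$ be the Zariski closure of $h_{d,r}(U)$ in $\Sigma((r+1)(d-2),r)$. Then $U$ is open and dense in $\Sigma(d,r)$, and $h_{d,r}$ is generically finite onto its image: there is a dense open subset $V$ of $H_{d,r}$ such that $h_{d,r}^{-1}(y)$ is finite for every $y\in V$. In other words, $H_{d,r}$ has dimension $N(d,r)=\dim\Sigma(d,r)$.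 -/

import Mathlib

open MvPolynomial
open scoped LinearAlgebra.Projectivization

namespace HessianMap

/-- The projective space `Σ(d,r)` of hypersurfaces of degree `d` in `ℙ^r` over `ℂ`: nonzero
homogeneous forms of degree `d` in the variables `x_0, …, x_r`, up to nonzero scalars. -/
def Hypersurface (d r : ℕ) : Type :=
  ℙ ℂ (homogeneousSubmodule (Fin (r + 1)) ℂ d)

/-- A representative equation of a hypersurface; it is unique up to a nonzero scalar. -/
noncomputable def Hypersurface.equation {d r : ℕ} (F : Hypersurface d r) :
    MvPolynomial (Fin (r + 1)) ℂ :=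
  (Projectivization.rep F : homogeneousSubmodule (Fin (r + 1)) ℂ d)

/-- The exponents of the monomials of degree `d` in `x_0, …, x_r`; they index the homogeneous
coordinates of `Σ(d,r)`. -/
abbrev Exponent (d r : ℕ) : Type := {m : Fin (r + 1) →₀ ℕ // m.degree = d}

/-- The homogeneous coordinates of a hypersurface: the coefficients of its equation. -/
noncomputable def Hypersurface.coords {d r : ℕ} (F : Hypersurface d r) : Exponent d r → ℂ :=
  fun m => coeff m.1 F.equation

/-- The Zariski topology on `Σ(d,r)`: it is generated by the complements of the zero loci of
homogeneous polynomials in the homogeneous coordinates. (These complements form a basis; the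
vanishing of a homogeneous polynomial does not depend on the chosen representative.) -/
instance Hypersurface.zariskiTopology (d r : ℕ) : TopologicalSpace (Hypersurface d r) :=
  TopologicalSpace.generateFrom
    {U | ∃ (P : MvPolynomial (Exponent d r) ℂ) (n : ℕ), P.IsHomogeneous n ∧
      U = {F : Hypersurface d r | eval F.coords P ≠ 0}}

/-- The Hessian polynomial of `f`: the determinant of the matrix of second partial derivatives. -/
noncomputable def hess {r : ℕ} (f : MvPolynomial (Fin (r + 1)) ℂ) :
    MvPolynomial (Fin (r + 1)) ℂ :=
  (Matrix.of fun i j : Fin (r + 1) => pderiv i (pderiv j f)).det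

theorem hess_isHomogeneous {d r : ℕ} {f : MvPolynomial (Fin (r + 1)) ℂ}
    (hf : f.IsHomogeneous d) : (hess f).IsHomogeneous ((r + 1) * (d - 2)) := by
  rw [hess, Matrix.det_apply]
  refine IsHomogeneous.sum _ _ _ fun σ _ => ?_
  have h : (∏ i : Fin (r + 1), (Matrix.of fun i j : Fin (r + 1) => pderiv i (pderiv j f))
      (σ i) i).IsHomogeneous (∑ _i : Fin (r + 1), (d - 2)) :=
    IsHomogeneous.prod _ _ _ fun i _ => (hf.pderiv (i := i)).pderiv (i := σ i)
  have h2 : (∑ _i : Fin (r + 1), (d - 2)) = (r + 1) * (d - 2) := by simp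
  rw [h2] at h
  exact (homogeneousSubmodule (Fin (r + 1)) ℂ _).smul_of_tower_mem (Equiv.Perm.sign σ) h

theorem Hypersurface.equation_isHomogeneous {d r : ℕ} (F : Hypersurface d r) :
    F.equation.IsHomogeneous d :=
  (Projectivization.rep F : homogeneousSubmodule (Fin (r + 1)) ℂ d).2

/-- The locus where the Hessian map is defined: the hypersurfaces whose Hessian polynomial does
not vanish identically. -/
def definedLocus (d r : ℕ) : Set (Hypersurface d r) := {F | hess F.equation ≠ 0}

/-- The Hessian map `h_{d,r}`, a rational map from `Σ(d,r)` to `Σ((r+1)(d-2),r)`, as a function on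
the complement of its indeterminacy locus: it sends the hypersurface `f = 0` to the hypersurface
`hess f = 0`. -/
noncomputable def hessianMap (d r : ℕ) :
    definedLocus d r → Hypersurface ((r + 1) * (d - 2)) r :=
  fun F => Projectivization.mk ℂ
    (⟨hess F.1.equation, hess_isHomogeneous F.1.equation_isHomogeneous⟩ :
      homogeneousSubmodule (Fin (r + 1)) ℂ ((r + 1) * (d - 2)))
    (fun h => F.2 (congrArg Subtype.val h))

/-- The Hessian variety `H_{d,r}`: the Zariski closure of the image of the Hessian map. -/
def hessianVariety (d r : ℕ) : Set (Hypersurface ((r + 1) * (d - 2)) r) :=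
  closure (Set.range (hessianMap d r))

/-- The Hessian map is generically finite onto its image: over a dense open subset of the closure
of its image, all its fibres are finite. -/
def IsGenericallyFiniteOntoImage (d r : ℕ) : Prop :=
  ∃ V : Set (hessianVariety d r), IsOpen V ∧ Dense V ∧
    ∀ G ∈ V, (hessianMap d r ⁻¹' {G.1}).Finite

/-- The number `N(d,r) = binom(d+r, d) - 1`. -/
def N (d r : ℕ) : ℕ := (d + r).choose d - 1

end HessianMap

/-! Everything follows from one infinitesimal computation on affine cones: the polynomial map
sending the coefficients of `f` to those of `hess f` has injective differential at `w = ∑ x_i^d + (∑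
x_i)^d`, suitably normalised. Put `e = d - 2` and `l = ∑ x_i`. The Hessian matrix of `w` is `diag
(x_i^e) + l^e J`, a rank-one perturbation of a diagonal matrix, so its adjugate is explicit. The
vanishing of the derivative of `det` in the direction `g` becomes, after clearing denominators, the
identity `IsInfinitesimallyTrivial e g`. Reducing it modulo `(x_a^e, x_b^e)` isolates `(∂_a - ∂_b)²
g`, a form of degree `e` that must be a combination of `x_a^e` and `x_b^e`. Hence every second
derivative of `g` is a combination of `x_i^e`, `x_j^e` and `l^e`, and the symmetry of third
derivatives forces `g = 0` (`eq_zero_of_isInfinitesimallyTrivial`). A third index distinct from `a,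
b` is needed, which is where `r ≥ 2` enters; `d ≥ 3` gives `e ≥ 1`.

By the Jacobian criterion, `N + 1` of the coefficients of the Hessian are algebraically independent
in `N + 1` parameters. Each parameter is then algebraic over these coefficients, which gives finite
fibres over a nonempty open set (`exists_open_finite_fibres`). The closure of the image is
irreducible, so this open set is dense.

For the dimension, chains of irreducible closed sets become chains of primes in the cone's
coordinate ring, bounded by Noether normalisation; the images of a flag of coordinate subspaces
supply a chain of length `N` (`topologicalKrullDim_closure_imageSet`). The same statement for a
linear parametrisation gives the dimension of `Σ(d,r)`. -/

namespace HessianMap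

/-! ### Ideals generated by two pure powers -/

section PowIdeal

variable {σ : Type*}

/-- The ideal `(x_i ^ e, x_j ^ e)`. -/
noncomputable def powIdeal (e : ℕ) (i j : σ) : Ideal (MvPolynomial σ ℂ) :=
  Ideal.span ((fun s => monomial s (1 : ℂ)) '' {Finsupp.single i e, Finsupp.single j e})

theorem mem_powIdeal {e : ℕ} {i j : σ} {p : MvPolynomial σ ℂ} :
    p ∈ powIdeal e i j ↔ ∀ m ∈ p.support, e ≤ m i ∨ e ≤ m j := by
  rw [powIdeal, mem_ideal_span_monomial_image]
  simp [Finsupp.single_le_iff]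

theorem X_pow_left_mem_powIdeal (e : ℕ) (i j : σ) :
    (X i ^ e : MvPolynomial σ ℂ) ∈ powIdeal e i j :=
  Ideal.subset_span ⟨_, Or.inl rfl, by simp [X_pow_eq_monomial]⟩

theorem X_pow_right_mem_powIdeal (e : ℕ) (i j : σ) :
    (X j ^ e : MvPolynomial σ ℂ) ∈ powIdeal e i j :=
  Ideal.subset_span ⟨_, Or.inr rfl, by simp [X_pow_eq_monomial]⟩

theorem mem_powIdeal_of_X_mul_mem {e : ℕ} {i j k : σ} (hki : k ≠ i) (hkj : k ≠ j)
    {p : MvPolynomial σ ℂ} (h : X k * p ∈ powIdeal e i j) : p ∈ powIdeal e i j := by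
  classical
  rw [mem_powIdeal] at h ⊢
  intro m hm
  have := h (Finsupp.single k 1 + m) (by rw [mem_support_iff, coeff_X_mul]; exact mem_support_iff.1 hm)
  simpa [Finsupp.single_apply, hki, hkj] using this

/-- The linear form contains a variable `x_k` foreign to the ideal, so it is a nonzerodivisor modulo
the ideal: among the monomials of `p` outside the ideal, one with maximal `x_k`-exponent survives
multiplication by `x_k` without cancellation. -/
theorem mem_powIdeal_of_sum_X_mul_mem [Fintype σ] {e : ℕ} {i j k : σ} (hki : k ≠ i) (hkj : k ≠ j)
    {p : MvPolynomial σ ℂ} (h : (∑ a, X a) * p ∈ powIdeal e i j) : p ∈ powIdeal e i j := by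
  classical
  rw [mem_powIdeal] at h ⊢
  by_contra hcon
  push Not at hcon
  obtain ⟨m₀, hm₀, hm₀'⟩ := hcon
  obtain ⟨m, hm, hmax⟩ := Finset.exists_max_image
    (p.support.filter fun m => m i < e ∧ m j < e) (fun m => m k) ⟨m₀, by simp_all⟩
  rw [Finset.mem_filter] at hm
  have hc : coeff (Finsupp.single k 1 + m) ((∑ a, X a) * p) = coeff m p := by
    rw [Finset.sum_mul, coeff_sum, Finset.sum_eq_single k]
    · rw [coeff_X_mul]
    · intro a _ hak
      rw [coeff_X_mul']
      split_ifs with ha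
      · by_contra hne
        have h1 := hmax (Finsupp.single k 1 + m - Finsupp.single a 1) (by
          rw [Finset.mem_filter]
          refine ⟨mem_support_iff.2 hne, ?_, ?_⟩
          · simp only [Finsupp.tsub_apply, Finsupp.add_apply, Finsupp.single_apply, hki, if_false]
            omega
          · simp only [Finsupp.tsub_apply, Finsupp.add_apply, Finsupp.single_apply, hkj, if_false]
            omega)
        simp [hak] at h1
      · rfl
    · simp
  have := h (Finsupp.single k 1 + m) (by rw [mem_support_iff, hc]; exact mem_support_iff.1 hm.1)
  simp only [Finsupp.add_apply, Finsupp.single_apply, hki, hkj, if_false] at this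
  omega

theorem mem_of_pow_mul_mem {R : Type*} [CommRing R] {I : Ideal R} {a : R}
    (ha : ∀ p, a * p ∈ I → p ∈ I) (n : ℕ) {p : R} (h : a ^ n * p ∈ I) : p ∈ I := by
  induction n with
  | zero => simpa using h
  | succ n ih => exact ih (ha _ (by rwa [← mul_assoc, ← pow_succ']))

theorem mem_of_prod_mul_mem {R ι : Type*} [CommRing R] {I : Ideal R} {s : Finset ι} {a : ι → R}
    (ha : ∀ k ∈ s, ∀ p, a k * p ∈ I → p ∈ I) {p : R} (h : (∏ k ∈ s, a k) * p ∈ I) : p ∈ I := by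
  classical
  induction s using Finset.induction_on with
  | empty => simpa using h
  | insert b s hb ih =>
    rw [Finset.prod_insert hb, mul_assoc] at h
    exact ih (fun k hk => ha k (Finset.mem_insert_of_mem hk)) (ha b (Finset.mem_insert_self _ _) _ h)

theorem IsHomogeneous.eq_of_mem_powIdeal {e : ℕ} {i j : σ} (hij : i ≠ j) (he : e ≠ 0)
    {p : MvPolynomial σ ℂ} (hp : p.IsHomogeneous e) (h : p ∈ powIdeal e i j) :
    p = C (coeff (Finsupp.single i e) p) * X i ^ e + C (coeff (Finsupp.single j e) p) * X j ^ e := by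
  classical
  rw [mem_powIdeal] at h
  have key : ∀ (m : σ →₀ ℕ) (a : σ), m.degree = e → e ≤ m a → m = Finsupp.single a e := by
    intro m a hm ha
    have h1 : Finsupp.single a e ≤ m := by simpa [Finsupp.single_le_iff] using ha
    obtain ⟨q, rfl⟩ := exists_add_of_le h1
    have : q.degree = 0 := by simpa using hm
    rw [Finsupp.degree_eq_zero_iff] at this
    simp [this]
  ext m
  simp only [coeff_add, coeff_C_mul, coeff_X_pow]
  by_cases hm : coeff m p = 0
  · rw [hm]
    split_ifs with h1 h2 h2
    · exact absurd (Finsupp.single_left_injective he (h1.trans h2.symm)) hij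
    · simp [h1, hm]
    · simp [h2, hm]
    · simp
  · have hdeg : m.degree = e := by
      by_contra hne
      exact hm (hp.coeff_eq_zero hne)
    rcases h m (mem_support_iff.2 hm) with h1 | h1
    · obtain rfl := key m i hdeg h1
      have : Finsupp.single j e ≠ Finsupp.single i e :=
        fun h2 => hij (Finsupp.single_left_injective he h2).symm
      simp [this]
    · obtain rfl := key m j hdeg h1
      have : Finsupp.single i e ≠ Finsupp.single j e :=
        fun h2 => hij (Finsupp.single_left_injective he h2)
      simp [this]

theorem IsHomogeneous.eq_of_X_pow_dvd {e : ℕ} {i : σ}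
    {p : MvPolynomial σ ℂ} (hp : p.IsHomogeneous e) (h : X i ^ e ∣ p) :
    ∃ c : ℂ, p = C c * X i ^ e := by
  obtain ⟨q, rfl⟩ := h
  rcases eq_or_ne q 0 with rfl | hq
  · exact ⟨0, by simp⟩
  have h1 : (X i ^ e * q).totalDegree = e :=
    hp.totalDegree (mul_ne_zero (pow_ne_zero _ (X_ne_zero _)) hq)
  rw [totalDegree_mul_of_isDomain (pow_ne_zero _ (X_ne_zero _)) hq, totalDegree_X_pow] at h1
  have : q.totalDegree = 0 := by omega
  rw [totalDegree_eq_zero_iff_eq_C] at this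
  exact ⟨_, by rw [mul_comm, ← this]⟩

end PowIdeal

/-! ### Injectivity of the linearised Hessian -/

section Linearized

variable {σ : Type*} [Fintype σ] [DecidableEq σ]

/-- The polynomial `(∂_i - ∂_j)² g`. -/
noncomputable def sqDiff (g : MvPolynomial σ ℂ) (i j : σ) : MvPolynomial σ ℂ :=
  pderiv i (pderiv i g) + pderiv j (pderiv j g) - 2 * pderiv i (pderiv j g)

omit [Fintype σ] in
theorem pderiv_comm (g : MvPolynomial σ ℂ) (i j : σ) :
    pderiv i (pderiv j g) = pderiv j (pderiv i g) := by
  induction g using MvPolynomial.induction_on with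
  | C a => simp
  | add p q hp hq => simp [hp, hq]
  | mul_X p k hp =>
    simp only [pderiv_mul, map_add, hp, pderiv_X]
    by_cases h1 : k = i <;> by_cases h2 : k = j <;> simp [h1, h2, Pi.single_apply] <;>
      (try split_ifs) <;> simp <;> ring

omit [Fintype σ] in
theorem sqDiff_comm (g : MvPolynomial σ ℂ) (i j : σ) : sqDiff g i j = sqDiff g j i := by
  rw [sqDiff, sqDiff, pderiv_comm g i j]; ring

omit [Fintype σ] [DecidableEq σ] in
theorem sqDiff_isHomogeneous {e : ℕ} {g : MvPolynomial σ ℂ} (hg : g.IsHomogeneous (e + 2))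
    (i j : σ) : (sqDiff g i j).IsHomogeneous e := by
  have h : ∀ a b, (pderiv a (pderiv b g)).IsHomogeneous e := fun a b => by
    simpa using (hg.pderiv (i := b)).pderiv (i := a)
  have h2 : (2 * pderiv i (pderiv j g)).IsHomogeneous e := by
    have := (isHomogeneous_C σ (2 : ℂ)).mul (h i j)
    rwa [zero_add, map_ofNat] at this
  exact ((h i i).add (h j j)).sub h2

omit [DecidableEq σ] in
theorem eq_zero_of_pderiv_pderiv_eq_zero {e : ℕ} {g : MvPolynomial σ ℂ}
    (hg : g.IsHomogeneous (e + 2)) (h : ∀ i j, pderiv i (pderiv j g) = 0) : g = 0 := by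
  have h1 : ∀ j, pderiv j g = 0 := fun j => by
    have := (hg.pderiv (i := j)).sum_X_mul_pderiv
    simp only [h, mul_zero, Finset.sum_const_zero] at this
    exact (smul_eq_zero.1 this.symm).resolve_left (by omega)
  have := hg.sum_X_mul_pderiv
  simp only [h1, mul_zero, Finset.sum_const_zero] at this
  exact (smul_eq_zero.1 this.symm).resolve_left (by omega)

theorem sum_X_ne_zero [Nonempty σ] : (∑ a : σ, X a : MvPolynomial σ ℂ) ≠ 0 := by
  intro h
  have := congrArg (eval (fun a => if a = Classical.arbitrary σ then (1 : ℂ) else 0)) h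
  simp at this

theorem pderiv_sum_X_pow (k : σ) (e : ℕ) :
    pderiv k ((∑ a : σ, X a : MvPolynomial σ ℂ) ^ e) =
      (e : MvPolynomial σ ℂ) * (∑ a : σ, X a) ^ (e - 1) := by
  rw [pderiv_pow, map_sum]
  simp [pderiv_X, Pi.single_apply]

omit [Fintype σ] in
theorem pderiv_X_pow_self' (k : σ) (e : ℕ) :
    pderiv k (X k ^ e : MvPolynomial σ ℂ) = (e : MvPolynomial σ ℂ) * X k ^ (e - 1) := by
  rw [pderiv_pow]; simp

omit [Fintype σ] [DecidableEq σ] in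
theorem pderiv_X_pow_of_ne {k i : σ} (h : i ≠ k) (e : ℕ) :
    pderiv k (X i ^ e : MvPolynomial σ ℂ) = 0 := by
  rw [pderiv_pow, pderiv_X_of_ne h]; simp

/-- The vanishing of the differential of the Hessian at `∑ x_i ^ (e + 2) + (∑ x_i) ^ (e + 2)`
in the direction `g`, up to normalisation. -/
def IsInfinitesimallyTrivial (e : ℕ) (g : MvPolynomial σ ℂ) : Prop :=
  2 * ∑ i, pderiv i (pderiv i g) * ∏ k ∈ Finset.univ.erase i, X k ^ e +
    (∑ a, X a) ^ e * ∑ i, ∑ j ∈ Finset.univ.erase i,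
      sqDiff g i j * ∏ k ∈ (Finset.univ.erase i).erase j, X k ^ e = 0

/-- Modulo `(x_a^e, x_b^e)` every product in the identity that retains the index `a` or `b` dies;
only the terms `(a, b)` and `(b, a)` remain. The remaining factors `l` and `x_k`, `k ≠ a, b`, are
nonzerodivisors modulo this ideal. -/
theorem sqDiff_mem_powIdeal {e : ℕ} {g : MvPolynomial σ ℂ}
    (hE : IsInfinitesimallyTrivial e g) {a b : σ} (hab : a ≠ b)
    (h3 : ∃ k, k ≠ a ∧ k ≠ b) : sqDiff g a b ∈ powIdeal e a b := by
  obtain ⟨k₀, hka, hkb⟩ := h3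
  set I := powIdeal e a b with hI
  have hprod : ∀ s : Finset σ, (a ∈ s ∨ b ∈ s) → ∏ k ∈ s, (X k ^ e : MvPolynomial σ ℂ) ∈ I := by
    rintro s (h | h)
    · exact I.mem_of_dvd (Finset.dvd_prod_of_mem _ h) (X_pow_left_mem_powIdeal e a b)
    · exact I.mem_of_dvd (Finset.dvd_prod_of_mem _ h) (X_pow_right_mem_powIdeal e a b)
  have hq := congrArg (Ideal.Quotient.mk I) hE
  rw [map_zero, map_add, map_mul, map_mul, map_sum, map_sum] at hq
  have hz : ∀ i j, ¬ (i = a ∧ j = b) → ¬ (i = b ∧ j = a) → j ≠ i → Ideal.Quotient.mk I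
      (sqDiff g i j * ∏ k ∈ (Finset.univ.erase i).erase j, X k ^ e) = 0 := by
    intro i j h1 h2 h3
    rw [Ideal.Quotient.eq_zero_iff_mem]
    refine I.mul_mem_left _ (hprod _ ?_)
    simp only [Finset.mem_erase, Finset.mem_univ, and_true]
    by_contra hcon
    grind
  have hS : ∀ i j, i ≠ j → ((i = a ∧ j = b) ∨ (i = b ∧ j = a)) →
      Ideal.Quotient.mk I (∑ j' ∈ Finset.univ.erase i,
        sqDiff g i j' * ∏ k ∈ (Finset.univ.erase i).erase j', X k ^ e) =
      Ideal.Quotient.mk I (sqDiff g i j * ∏ k ∈ (Finset.univ.erase i).erase j, X k ^ e) := by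
    intro i j hij h
    rw [map_sum]
    refine Finset.sum_eq_single j (fun j' hj' hne => hz i j' ?_ ?_ (Finset.ne_of_mem_erase hj')) ?_
    · grind
    · grind
    · intro h
      exact absurd (Finset.mem_erase.2 ⟨hij.symm, Finset.mem_univ _⟩) h
  have hq0 : Ideal.Quotient.mk I (∑ i, pderiv i (pderiv i g) *
      ∏ k ∈ Finset.univ.erase i, X k ^ e) = 0 := by
    rw [Ideal.Quotient.eq_zero_iff_mem]
    refine I.sum_mem fun i _ => I.mul_mem_left _ (hprod _ ?_)
    simp only [Finset.mem_erase, Finset.mem_univ, and_true]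
    by_contra hcon
    grind
  rw [← map_sum, hq0, mul_zero, zero_add, Finset.sum_eq_add (M := MvPolynomial σ ℂ ⧸ I) a b hab] at hq
  rotate_left
  · rintro i - ⟨h1, h2⟩
    rw [map_sum]
    refine Finset.sum_eq_zero fun j hj => hz i j ?_ ?_ (Finset.ne_of_mem_erase hj) <;> grind
  · simp
  · simp
  rw [hS a b hab (by simp), hS b a hab.symm (by simp), sqDiff_comm g b a,
    Finset.erase_right_comm, ← map_add, ← map_mul, Ideal.Quotient.eq_zero_iff_mem] at hq
  have h1 := mem_of_pow_mul_mem (fun p hp => mem_powIdeal_of_sum_X_mul_mem hka hkb hp) e hq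
  have h2 : (∏ k ∈ (Finset.univ.erase b).erase a, X k ^ e) * sqDiff g a b ∈ I := by
    have := I.mul_mem_left (C (1 / 2 : ℂ)) h1
    rw [← two_mul, ← mul_assoc] at this
    have h2 : (C (1 / 2 : ℂ) * 2 : MvPolynomial σ ℂ) = 1 := by
      rw [← map_ofNat (C (σ := σ) (R := ℂ)) 2, ← C_mul]; norm_num
    rwa [h2, one_mul, mul_comm] at this
  refine mem_of_prod_mul_mem (fun k hk p hp => ?_) h2
  refine mem_of_pow_mul_mem (fun p hp => mem_powIdeal_of_X_mul_mem ?_ ?_ hp) e hp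
  · simp only [Finset.mem_erase] at hk; exact hk.1
  · simp only [Finset.mem_erase] at hk; exact hk.2.1

/-- Membership in `(x_i^e, x_j^e)` makes each `sqDiff g i j` explicit, the identity then makes each
`∂_i² g` explicit, and equality of mixed third derivatives leaves only the zero solution for the
constants. -/
theorem eq_zero_of_isInfinitesimallyTrivial {e : ℕ} (he : e ≠ 0)
    (h3 : ∀ i j : σ, ∃ k, k ≠ i ∧ k ≠ j) [Nonempty σ] {g : MvPolynomial σ ℂ}
    (hg : g.IsHomogeneous (e + 2)) (hE : IsInfinitesimallyTrivial e g) : g = 0 := by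
  set l : MvPolynomial σ ℂ := ∑ a, X a with hl
  have hl0 : l ≠ 0 := sum_X_ne_zero
  have hGh : ∀ a b, (pderiv a (pderiv b g)).IsHomogeneous e := fun a b => by
    simpa using (hg.pderiv (i := b)).pderiv (i := a)
  have hlh : (l ^ e).IsHomogeneous e := by
    simpa using (IsHomogeneous.sum Finset.univ _ 1 fun a _ => isHomogeneous_X ℂ a).pow e
  let α : σ → σ → ℂ := fun i j => coeff (Finsupp.single i e) (sqDiff g i j)
  have hα : ∀ i j, i ≠ j → sqDiff g i j = C (α i j) * X i ^ e + C (α j i) * X j ^ e := by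
    intro i j hij
    rw [IsHomogeneous.eq_of_mem_powIdeal hij he (sqDiff_isHomogeneous hg i j)
      (sqDiff_mem_powIdeal hE hij (h3 i j))]
    simp only [α]
    rw [sqDiff_comm g j i]
  let Q : σ → MvPolynomial σ ℂ := fun i => ∏ k ∈ Finset.univ.erase i, X k ^ e
  let γ : σ → ℂ := fun i => ∑ j ∈ Finset.univ.erase i, α j i
  have hmul : ∀ i j, i ≠ j →
      (X i ^ e * ∏ k ∈ (Finset.univ.erase i).erase j, X k ^ e : MvPolynomial σ ℂ) = Q j := by
    intro i j hij
    rw [Finset.erase_right_comm]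
    exact Finset.mul_prod_erase (Finset.univ.erase j) (fun k => (X k ^ e : MvPolynomial σ ℂ))
      (Finset.mem_erase.2 ⟨hij, Finset.mem_univ _⟩)
  have hmul' : ∀ i j, i ≠ j →
      (X j ^ e * ∏ k ∈ (Finset.univ.erase i).erase j, X k ^ e : MvPolynomial σ ℂ) = Q i := by
    intro i j hij
    rw [Finset.erase_right_comm, hmul j i hij.symm]
  have hsum : ∑ i, ∑ j ∈ Finset.univ.erase i,
      sqDiff g i j * ∏ k ∈ (Finset.univ.erase i).erase j, X k ^ e = 2 * ∑ i, C (γ i) * Q i := by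
    -- Each pair contributes once to `Q i` and once to `Q j`; by the symmetry of the double sum both
    -- halves agree.
    have h1 : ∀ i, ∑ j ∈ Finset.univ.erase i,
        sqDiff g i j * ∏ k ∈ (Finset.univ.erase i).erase j, X k ^ e =
        ∑ j ∈ Finset.univ.erase i, C (α i j) * Q j + ∑ j ∈ Finset.univ.erase i, C (α j i) * Q i := by
      intro i
      rw [← Finset.sum_add_distrib]
      refine Finset.sum_congr rfl fun j hj => ?_
      have hij : i ≠ j := (Finset.ne_of_mem_erase hj).symm
      rw [hα i j hij, add_mul, mul_assoc, mul_assoc, hmul i j hij, hmul' i j hij]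
    have h2 : ∑ i, ∑ j ∈ Finset.univ.erase i, C (α i j) * Q j =
        ∑ i, ∑ j ∈ Finset.univ.erase i, C (α j i) * Q i := by
      refine Finset.sum_comm' fun x y => ?_
      simp [eq_comm]
    rw [Finset.sum_congr rfl fun i _ => h1 i, Finset.sum_add_distrib, h2, two_mul]
    simp only [γ, map_sum, Finset.sum_mul]
  have hmain : ∑ i, (pderiv i (pderiv i g) + C (γ i) * l ^ e) * Q i = 0 := by
    have h := hE
    rw [IsInfinitesimallyTrivial, hsum] at h
    have h2 : (2 : MvPolynomial σ ℂ) *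
        ∑ i, (pderiv i (pderiv i g) + C (γ i) * l ^ e) * Q i = 0 := by
      rw [← h]
      simp only [add_mul, Finset.sum_add_distrib, mul_add, Finset.mul_sum]
      congr 1
      refine Finset.sum_congr rfl fun i _ => ?_
      ring
    exact (mul_eq_zero.1 h2).resolve_left two_ne_zero
  have hX : ∀ i : σ, Prime (X i : MvPolynomial σ ℂ) := fun i => X_prime
  have hdvd : ∀ i, ∃ c : ℂ, pderiv i (pderiv i g) + C (γ i) * l ^ e = C c * X i ^ e := by
    intro i
    refine IsHomogeneous.eq_of_X_pow_dvd ((hGh i i).add ?_) ?_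
    · simpa using (isHomogeneous_C σ (γ i)).mul hlh
    -- In `hmain` every `Q j` with `j ≠ i` is divisible by `x_i^e`, whereas `Q i` is prime to `x_i`.
    refine (hX i).pow_dvd_of_dvd_mul_right (b := Q i) e ?_ ?_
    · rw [(hX i).dvd_finsetProd_iff]
      rintro ⟨k, hk, hdk⟩
      have := (hX i).dvd_of_dvd_pow hdk
      rw [X_dvd_X] at this
      exact Finset.ne_of_mem_erase hk this.symm
    · rw [← Finset.add_sum_erase _ _ (Finset.mem_univ i)] at hmain
      rw [eq_neg_of_add_eq_zero_left hmain, dvd_neg]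
      refine Finset.dvd_sum fun j hj => Dvd.dvd.mul_left ?_ _
      exact Finset.dvd_prod_of_mem (fun k => (X k ^ e : MvPolynomial σ ℂ))
        (Finset.mem_erase.2 ⟨(Finset.ne_of_mem_erase hj).symm, Finset.mem_univ _⟩)
  choose δ hδ using hdvd
  have hδsum : ∑ i, δ i = 0 := by
    have h1 : ∀ i, (pderiv i (pderiv i g) + C (γ i) * l ^ e) * Q i =
        C (δ i) * ∏ k, X k ^ e := by
      intro i
      rw [hδ, mul_assoc]
      congr 1
      exact Finset.mul_prod_erase _ (fun k => (X k ^ e : MvPolynomial σ ℂ)) (Finset.mem_univ i)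
    rw [Finset.sum_congr rfl fun i _ => h1 i, ← Finset.sum_mul] at hmain
    rcases mul_eq_zero.1 hmain with h | h
    · rw [← map_sum] at h
      exact (C_injective σ ℂ) (h.trans C_0.symm)
    · exact absurd h (Finset.prod_ne_zero_iff.2 fun k _ => pow_ne_zero _ (X_ne_zero k))
  have hdiag : ∀ i, pderiv i (pderiv i g) = C (δ i) * X i ^ e - C (γ i) * l ^ e :=
    fun i => eq_sub_of_add_eq (hδ i)
  have hoff : ∀ i j, i ≠ j → 2 * pderiv i (pderiv j g) =
      C (δ i - α i j) * X i ^ e + C (δ j - α j i) * X j ^ e - C (γ i + γ j) * l ^ e := by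
    intro i j hij
    have := hα i j hij
    rw [sqDiff, hdiag, hdiag] at this
    simp only [C_add, C_sub]
    linear_combination -this
  have he' : (e : MvPolynomial σ ℂ) ≠ 0 := by exact_mod_cast he
  have cancel : ∀ (c : ℂ) (q : MvPolynomial σ ℂ), q ≠ 0 → C c * ((e : MvPolynomial σ ℂ) * q ^ (e - 1)) = 0 → c = 0 := by
    intro c q hq h
    rcases mul_eq_zero.1 h with h | h
    · simpa using h
    · exact absurd h (mul_ne_zero he' (pow_ne_zero _ hq))
  -- For distinct `i, j, k`, comparing `∂_k ∂_i ∂_j g` with `∂_j ∂_i ∂_k g` leaves only multiples of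
  -- `l^(e-1)`.
  have hγ : ∀ j k, γ j = γ k := by
    intro j k
    rcases eq_or_ne j k with rfl | hjk
    · rfl
    obtain ⟨i, hij, hik⟩ := h3 j k
    have h1 := congrArg (pderiv k) (hoff i j hij)
    have h2 := congrArg (pderiv j) (hoff i k hik)
    have h4 : pderiv k (2 * pderiv i (pderiv j g)) = pderiv j (2 * pderiv i (pderiv k g)) := by
      rw [two_mul, two_mul, map_add, map_add, pderiv_comm (pderiv j g) k i, pderiv_comm g k j,
        pderiv_comm (pderiv k g) i j]
    rw [h1, h2] at h4
    simp only [Derivation.map_add, Derivation.map_sub, pderiv_C_mul, pderiv_X_pow_of_ne hij, pderiv_X_pow_of_ne hik,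
      pderiv_X_pow_of_ne hjk, pderiv_X_pow_of_ne hjk.symm, hl, pderiv_sum_X_pow] at h4
    have := cancel (γ j - γ k) l hl0 (by
      simp only [C_sub, C_add] at h4 ⊢
      linear_combination -h4)
    exact sub_eq_zero.1 this
  -- Compare `∂_i (∂_i ∂_j g)` with `∂_j (∂_i² g)`: once all `γ` agree, the `l^(e-1)` terms cancel
  -- and a multiple of `x_i^(e-1)` remains.
  have hαδ : ∀ i j, i ≠ j → α i j = δ i := by
    intro i j hij
    have h1 := congrArg (pderiv j) (hdiag i)
    have h2 := congrArg (pderiv i) (hoff i j hij)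
    have h4 : pderiv i (2 * pderiv i (pderiv j g)) = 2 * pderiv j (pderiv i (pderiv i g)) := by
      rw [two_mul, two_mul, map_add, pderiv_comm g i j, pderiv_comm (pderiv i g) i j]
    rw [h1, h2] at h4
    simp only [Derivation.map_add, Derivation.map_sub, pderiv_C_mul, pderiv_X_pow_of_ne hij, pderiv_X_pow_of_ne hij.symm,
      pderiv_X_pow_self', hl, pderiv_sum_X_pow] at h4
    have := cancel (δ i - α i j) (X i) (X_ne_zero i) (by
      simp only [C_sub, C_add, hγ j i] at h4 ⊢
      linear_combination h4)
    exact (sub_eq_zero.1 this).symm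
  have hγδ : ∀ i, γ i = - δ i := by
    intro i
    have : γ i = ∑ j ∈ Finset.univ.erase i, δ j :=
      Finset.sum_congr rfl fun j hj => hαδ j i (Finset.ne_of_mem_erase hj)
    rw [this, eq_neg_iff_add_eq_zero, Finset.sum_erase_add _ _ (Finset.mem_univ i), hδsum]
  -- Since `γ = -δ` is constant, the `δ i` are equal and sum to zero.
  have hδ0 : ∀ i, δ i = 0 := by
    intro i
    have h1 : ∀ j ∈ Finset.univ, δ j = δ i := fun j _ => by
      have := hγ j i
      rw [hγδ, hγδ] at this
      exact neg_injective this
    rw [Finset.sum_congr rfl h1, Finset.sum_const, smul_eq_zero] at hδsum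
    exact hδsum.resolve_left (by simp)
  have hγ0 : ∀ i, γ i = 0 := fun i => by rw [hγδ, hδ0, neg_zero]
  refine eq_zero_of_pderiv_pderiv_eq_zero hg fun i j => ?_
  rcases eq_or_ne i j with rfl | hij
  · rw [hdiag, hδ0, hγ0]; simp
  · have := hoff i j hij
    rw [hαδ i j hij, hαδ j i hij.symm, hδ0, hδ0, hγ0, hγ0] at this
    simpa using this

end Linearized

/-! ### Jacobian criterion, algebraic equations and Krull dimension -/

section Jacobian

theorem pderiv_aeval {σ τ : Type*} [Fintype τ] (Φ : τ → MvPolynomial σ ℂ) (P : MvPolynomial τ ℂ)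
    (a : σ) : pderiv a (aeval Φ P) = ∑ j, aeval Φ (pderiv j P) * pderiv a (Φ j) := by
  classical
  induction P using MvPolynomial.induction_on with
  | C c => simp
  | add p q hp hq => simp only [map_add, hp, hq, add_mul, Finset.sum_add_distrib]
  | mul_X p k hp =>
    have h : ∀ j, aeval Φ (pderiv j (p * X k)) * pderiv a (Φ j) =
        Φ k * (aeval Φ (pderiv j p) * pderiv a (Φ j)) +
          if j = k then aeval Φ p * pderiv a (Φ j) else 0 := by
      intro j
      rw [pderiv_mul, map_add, map_mul, map_mul, aeval_X]
      split_ifs with hjk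
      · rw [hjk, pderiv_X_self, map_one]; ring
      · rw [pderiv_X_of_ne (Ne.symm hjk), map_zero]; ring
    rw [map_mul, aeval_X, pderiv_mul, hp, Finset.sum_congr rfl fun j _ => h j,
      Finset.sum_add_distrib, ← Finset.mul_sum, Finset.sum_ite_eq' Finset.univ k]
    simp only [Finset.mem_univ, if_true]
    ring

/-- Differentiating a relation `P(Φ) = 0` and inverting the Jacobian over the fraction field shows
that all partial derivatives of `P` are relations too. Their degree is smaller, so by induction they
vanish, and in characteristic zero `P` is constant. -/
theorem algebraicIndependent_of_det_ne_zero {σ : Type*} [Fintype σ] [DecidableEq σ]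
    (Φ : σ → MvPolynomial σ ℂ) (p : σ → ℂ)
    (h : (Matrix.of fun j a => eval p (pderiv a (Φ j))).det ≠ 0) : AlgebraicIndependent ℂ Φ := by
  have hdet : (Matrix.of fun j a => pderiv a (Φ j)).det ≠ 0 := by
    intro h0
    apply h
    have := congrArg (eval p) h0
    rw [RingHom.map_det, map_zero] at this
    exact this
  have key : ∀ (n : ℕ) (P : MvPolynomial σ ℂ), (∀ m : σ →₀ ℕ, n ≤ m.degree → coeff m P = 0) →
      aeval Φ P = 0 → P = 0 := by
    intro n
    induction n with
    | zero => intro P hP _; ext m; simpa using hP m (Nat.zero_le _)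
    | succ n ih =>
      intro P hP h0
      have h1 : ∀ j, aeval Φ (pderiv j P) = 0 := by
        have : Matrix.vecMul (fun j => aeval Φ (pderiv j P))
            (Matrix.of fun j a => pderiv a (Φ j)) = 0 := by
          ext1 a
          have := pderiv_aeval Φ P a
          rw [h0, map_zero] at this
          simpa [Matrix.vecMul, dotProduct] using this.symm
        exact fun j => congrFun (Matrix.eq_zero_of_vecMul_eq_zero hdet this) j
      have h2 : ∀ j, pderiv j P = 0 := fun j => ih _ (fun m hm => by
        rw [coeff_pderiv, hP _ (by simp; omega), zero_mul]) (h1 j)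
      have h3 : ∀ m, m ≠ 0 → coeff m P = 0 := by
        intro m hm
        obtain ⟨i, hi⟩ := Finsupp.ne_iff.1 hm
        have h4 := coeff_pderiv (i := i) P (m - Finsupp.single i 1)
        rw [h2, coeff_zero, tsub_add_cancel_of_le
          (by simpa [Finsupp.single_le_iff, Nat.one_le_iff_ne_zero] using hi)] at h4
        exact (mul_eq_zero.1 h4.symm).resolve_right (Nat.cast_add_one_ne_zero _)
      have h4 : P = C (coeff 0 P) := by
        ext m
        rcases eq_or_ne m 0 with rfl | hm
        · simp
        · rw [h3 m hm, coeff_C, if_neg hm.symm]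
      rw [h4, aeval_C, MvPolynomial.algebraMap_eq, C_eq_zero] at h0
      rw [h4, h0, C_0]
  rw [algebraicIndependent_iff]
  exact fun P h0 => key (P.totalDegree + 1) P
    (fun m hm => coeff_eq_zero_of_totalDegree_lt (by
      rw [Finsupp.degree_apply] at hm; exact hm)) h0

/-- The differential at `p` of the polynomial map `Φ` is injective. -/
def HasInjectiveDifferentialAt {σ τ : Type*} [Fintype σ] (Φ : τ → MvPolynomial σ ℂ)
    (p : σ → ℂ) : Prop :=
  ∀ v : σ → ℂ, (∀ m, ∑ a, v a * eval p (pderiv a (Φ m)) = 0) → v = 0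

/-- An injective Jacobian has rows spanning the dual space; the rows of a basis chosen among them
form an invertible square minor. -/
theorem HasInjectiveDifferentialAt.exists_algebraicIndependent {σ τ : Type*} [Fintype σ]
    [Finite τ] {Φ : τ → MvPolynomial σ ℂ} {p : σ → ℂ} (h : HasInjectiveDifferentialAt Φ p) :
    ∃ s : σ → τ, AlgebraicIndependent ℂ (Φ ∘ s) := by
  classical
  let J : τ → σ → ℂ := fun m a => eval p (pderiv a (Φ m))
  have hspan : Submodule.span ℂ (Set.range J) = ⊤ := by
    by_contra hne
    obtain ⟨f, hf0, hf⟩ := Submodule.exists_le_ker_of_lt_top _ (lt_top_iff_ne_top.2 hne)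
    have hfv : ∀ w : σ → ℂ, f w = ∑ a, f (Pi.single a 1) * w a := by
      intro w
      conv_lhs => rw [← Finset.univ_sum_single w]
      rw [map_sum]
      refine Finset.sum_congr rfl fun a _ => ?_
      have : (Pi.single a (w a) : σ → ℂ) = w a • Pi.single a 1 := by
        rw [← Pi.single_smul, smul_eq_mul, mul_one]
      rw [this, map_smul, smul_eq_mul, mul_comm]
    have := h (fun a => f (Pi.single a 1)) fun m => by
      rw [← hfv (J m)]
      exact hf (Submodule.subset_span ⟨m, rfl⟩)
    apply hf0
    ext a
    simpa using congrFun this a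
  obtain ⟨κ, a, -, hsp, hli⟩ := exists_linearIndependent' ℂ J
  rw [hspan] at hsp
  let b := Module.Basis.mk hli hsp.ge
  let e : σ ≃ κ := (Pi.basisFun ℂ σ).indexEquiv b
  refine ⟨a ∘ e, algebraicIndependent_of_det_ne_zero _ p ?_⟩
  have hli' : LinearIndependent ℂ (fun j => J (a (e j))) := hli.comp e e.injective
  have := Matrix.linearIndependent_rows_iff_isUnit (A := Matrix.of fun j => J (a (e j))).1 hli'
  exact ((Matrix.isUnit_iff_isUnit_det _).1 this).ne_zero

theorem AlgebraicIndependent.card_le {σ ι : Type} [Fintype σ] [Fintype ι]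
    {x : ι → MvPolynomial σ ℂ} (h : AlgebraicIndependent ℂ x) : Fintype.card ι ≤ Fintype.card σ := by
  have := h.cardinalMk_le_trdeg
  rw [MvPolynomial.trdeg_of_isDomain] at this
  simpa using this

/-- If `#σ` of the polynomials `Φ_m` are algebraically independent, then every variable satisfies
an algebraic equation over the polynomials `Φ_m`. -/
theorem exists_algebraic_equation {σ τ : Type} [Fintype σ] {Φ : τ → MvPolynomial σ ℂ}
    {s : σ → τ} (h : AlgebraicIndependent ℂ (Φ ∘ s)) (a : σ) :
    ∃ (Q : Polynomial (MvPolynomial τ ℂ)) (n : ℕ), aeval Φ (Q.coeff n) ≠ 0 ∧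
      ∀ t : σ → ℂ, (Q.map (eval fun m => eval t (Φ m))).IsRoot (t a) := by
  -- An independent family as large as the transcendence degree is a transcendence basis, so `X a`
  -- is algebraic over it; the coefficients of its equation are then lifted to polynomials in the `Φ
  -- m`.
  have hb : IsTranscendenceBasis ℂ (Φ ∘ s) :=
    h.isTranscendenceBasis_of_trdeg_le_of_finite (by rw [MvPolynomial.trdeg_of_isDomain]; simp)
  obtain ⟨q, hq0, hq⟩ := hb.isAlgebraic.isAlgebraic (X a)
  have hle : Algebra.adjoin ℂ (Set.range (Φ ∘ s)) ≤ (aeval (R := ℂ) Φ).range := by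
    rw [← Algebra.adjoin_range_eq_range_aeval]
    exact Algebra.adjoin_mono (Set.range_comp_subset_range _ _)
  obtain ⟨Q, hQ⟩ := Polynomial.map_surjective (aeval (R := ℂ) Φ).rangeRestrict.toRingHom
    (aeval (R := ℂ) Φ).rangeRestrict_surjective (q.map (Subalgebra.inclusion hle).toRingHom)
  have hcoeff : ∀ n, aeval Φ (Q.coeff n) = (q.coeff n : MvPolynomial σ ℂ) := by
    intro n
    have := congrArg (fun q => ((q.coeff n : (aeval (R := ℂ) Φ).range) : MvPolynomial σ ℂ)) hQ
    simp only [Polynomial.coeff_map] at this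
    exact this
  refine ⟨Q, q.natDegree, ?_, fun t => ?_⟩
  · rw [hcoeff]
    simpa using hq0
  · have hmap : Q.map (aeval (R := ℂ) Φ).toRingHom =
        q.map (algebraMap (Algebra.adjoin ℂ (Set.range (Φ ∘ s))) (MvPolynomial σ ℂ)) := by
      ext1 n
      rw [Polynomial.coeff_map, Polynomial.coeff_map]
      exact hcoeff n
    have h1 : (Q.map (aeval (R := ℂ) Φ).toRingHom).eval (X a) = 0 := by
      rw [hmap, Polynomial.eval_map_algebraMap]; exact hq
    have h2 := congrArg (eval t) h1
    rw [Polynomial.eval_map, Polynomial.hom_eval₂, map_zero, eval_X] at h2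
    rw [Polynomial.IsRoot, Polynomial.eval_map]
    have hcomp : (eval t).comp (aeval (R := ℂ) Φ).toRingHom = eval fun m => eval t (Φ m) :=
      MvPolynomial.ringHom_ext (fun c => by simp) (fun m => by simp)
    rw [← hcomp]
    exact h2

/-- Noether normalisation makes `A` integral over `n` variables, and these remain algebraically
independent in the target, so `n ≤ #σ`. -/
theorem ringKrullDim_le_of_injective {σ A : Type} [Fintype σ] [CommRing A] [Algebra ℂ A]
    [Algebra.FiniteType ℂ A] (f : A →ₐ[ℂ] MvPolynomial σ ℂ) (hf : Function.Injective f) :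
    ringKrullDim A ≤ Fintype.card σ := by
  have : Nontrivial A := ⟨0, 1, fun h => by simpa using congrArg f h⟩
  obtain ⟨n, g, hg, hint⟩ := exists_integral_inj_algHom_of_fg ℂ A
  have hn : n ≤ Fintype.card σ := by
    have h1 : AlgebraicIndependent ℂ (fun i => f (g (X i))) := by
      have := (MvPolynomial.algebraicIndependent_X (Fin n) ℂ).map' (f := f.comp g)
        (by rw [AlgHom.coe_comp]; exact hf.comp hg)
      exact this
    simpa using AlgebraicIndependent.card_le h1
  have h2 : ringKrullDim A ≤ ringKrullDim (MvPolynomial (Fin n) ℂ) := by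
    algebraize [g.toRingHom]
    have : Algebra.IsIntegral (MvPolynomial (Fin n) ℂ) A := ⟨hint⟩
    refine Order.krullDim_le_of_strictMono
      (PrimeSpectrum.comap (algebraMap (MvPolynomial (Fin n) ℂ) A)) fun P Q hPQ => ?_
    exact Ideal.IsIntegral.comap_lt_comap hPQ
  rw [MvPolynomial.ringKrullDim_of_isNoetherianRing] at h2
  refine h2.trans ?_
  rw [ringKrullDim_eq_zero_of_field, zero_add]
  simpa using hn

end Jacobian

/-! ### Homogeneous coordinates on the space of hypersurfaces -/

section Coordinates

variable {D r : ℕ}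

noncomputable instance : Fintype (Exponent D r) :=
  Fintype.subtype (Finset.finsuppAntidiag (Finset.univ : Finset (Fin (r + 1))) D) fun m => by
    rw [Finset.mem_finsuppAntidiag]
    simp [Finsupp.degree_eq_sum]

theorem card_exponent (d r : ℕ) : Fintype.card (Exponent d r) = (d + r).choose d := by
  have h : Fintype.card (Exponent d r) =
      (Finset.finsuppAntidiag (Finset.univ : Finset (Fin (r + 1))) d).card :=
    Fintype.card_of_subtype _ fun m => by
      rw [Finset.mem_finsuppAntidiag]
      simp [Finsupp.degree_eq_sum]
  rw [h, Finset.card_finsuppAntidiag_nat_eq_choose]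
  simp only [Finset.card_univ, Fintype.card_fin]
  congr 1
  omega

/-- A form is determined by its coefficients. -/
noncomputable def coeffEquiv (D r : ℕ) :
    homogeneousSubmodule (Fin (r + 1)) ℂ D ≃ₗ[ℂ] (Exponent D r → ℂ) where
  toFun p m := coeff m.1 p.1
  map_add' p q := by ext m; simp
  map_smul' c p := by ext m; simp
  invFun y := ⟨∑ m, monomial m.1 (y m), Submodule.sum_mem _ fun m _ =>
    isHomogeneous_monomial _ m.2⟩
  left_inv p := by
    classical
    ext m
    simp only [coeff_sum, coeff_monomial]
    by_cases hm : m.degree = D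
    · rw [Finset.sum_eq_single ⟨m, hm⟩]
      · simp
      · intro b _ hb
        rw [if_neg]
        exact fun h => hb (Subtype.ext h)
      · simp
    · rw [Finset.sum_eq_zero]
      · symm
        by_contra h
        exact hm (by
          by_contra hne
          exact h (IsHomogeneous.coeff_eq_zero p.2 hne))
      · intro b _
        rw [if_neg]
        rintro rfl
        exact hm b.2
  right_inv y := by
    classical
    ext m
    simp only [coeff_sum, coeff_monomial]
    rw [Finset.sum_eq_single m]
    · simp
    · intro b _ hb
      rw [if_neg]
      exact fun h => hb (Subtype.ext h)
    · simp

theorem Hypersurface.coords_eq (F : Hypersurface D r) :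
    F.coords = coeffEquiv D r (Projectivization.rep F) := rfl

theorem Hypersurface.coords_ne_zero (F : Hypersurface D r) : F.coords ≠ 0 := by
  rw [F.coords_eq, Ne, LinearEquiv.map_eq_zero_iff]
  exact Projectivization.rep_nonzero F

/-- The hypersurface with the equation `v`. -/
noncomputable def Hypersurface.mk (v : homogeneousSubmodule (Fin (r + 1)) ℂ D) (hv : v ≠ 0) :
    Hypersurface D r :=
  Projectivization.mk ℂ v hv

theorem Hypersurface.eq_mk_of_coords_eq {F : Hypersurface D r} {c : ℂ}
    {v : homogeneousSubmodule (Fin (r + 1)) ℂ D} (hv : v ≠ 0)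
    (h : F.coords = c • coeffEquiv D r v) : F = Hypersurface.mk v hv := by
  rw [F.coords_eq, ← map_smul] at h
  have h1 := (coeffEquiv D r).injective h
  have h2 : F = Projectivization.mk ℂ _ (Projectivization.rep_nonzero F) :=
    (Projectivization.mk_rep F).symm
  exact h2.trans ((Projectivization.mk_eq_mk_iff' ℂ _ _ _ hv).2 ⟨c, h1.symm⟩)

theorem Hypersurface.exists_coords_mk (v : homogeneousSubmodule (Fin (r + 1)) ℂ D) (hv : v ≠ 0) :
    ∃ c : ℂ, c ≠ 0 ∧ (Hypersurface.mk v hv).coords = c • coeffEquiv D r v := by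
  obtain ⟨a, ha⟩ := Projectivization.exists_smul_eq_mk_rep ℂ v hv
  exact ⟨a, a.ne_zero, (congrArg (coeffEquiv D r) ha.symm).trans (map_smul _ (a : ℂ) v)⟩

end Coordinates

/-! ### Homogeneity and restriction to lines -/

section Homogeneous

variable {τ : Type*}

theorem eval_smul_of_isHomogeneous {P : MvPolynomial τ ℂ} {n : ℕ} (hP : P.IsHomogeneous n)
    (c : ℂ) (y : τ → ℂ) : eval (c • y) P = c ^ n * eval y P := by
  rw [eval_eq, eval_eq, Finset.mul_sum]
  refine Finset.sum_congr rfl fun m hm => ?_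
  have hd : m.degree = n := by
    by_contra hne
    exact mem_support_iff.1 hm (hP.coeff_eq_zero hne)
  simp only [Pi.smul_apply, smul_eq_mul, mul_pow, Finset.prod_mul_distrib]
  rw [Finset.prod_pow_eq_pow_sum, ← Finsupp.degree_apply, hd]
  ring

/-- The polynomial `P` restricted to the line spanned by `y`. -/
noncomputable def restrictLine (P : MvPolynomial τ ℂ) (y : τ → ℂ) : Polynomial ℂ :=
  ∑ j ∈ Finset.range (P.totalDegree + 1),
    Polynomial.monomial j (eval y (homogeneousComponent j P))

theorem restrictLine_eval (P : MvPolynomial τ ℂ) (y : τ → ℂ) (c : ℂ) :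
    (restrictLine P y).eval c = eval (c • y) P := by
  conv_rhs => rw [← sum_homogeneousComponent P]
  rw [restrictLine, Polynomial.eval_finsetSum, map_sum]
  refine Finset.sum_congr rfl fun j _ => ?_
  rw [eval_smul_of_isHomogeneous (homogeneousComponent_isHomogeneous j P), Polynomial.eval_monomial,
    mul_comm]

theorem restrictLine_coeff (P : MvPolynomial τ ℂ) (y : τ → ℂ) (j : ℕ) :
    (restrictLine P y).coeff j = eval y (homogeneousComponent j P) := by
  rw [restrictLine, Polynomial.finsetSum_coeff]
  simp only [Polynomial.coeff_monomial]
  rw [Finset.sum_ite_eq' (Finset.range _) j]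
  split_ifs with h
  · rfl
  · rw [homogeneousComponent_eq_zero _ _ (by simpa using h), map_zero]

theorem restrictLine_eq_zero_iff (P : MvPolynomial τ ℂ) (y : τ → ℂ) :
    restrictLine P y = 0 ↔ ∀ c : ℂ, eval (c • y) P = 0 :=
  ⟨fun h c => by rw [← restrictLine_eval, h, Polynomial.eval_zero],
    fun h => Polynomial.funext fun c => by rw [restrictLine_eval, h, Polynomial.eval_zero]⟩

/-- A polynomial function which is homogeneous is given by a homogeneous polynomial. -/
theorem isHomogeneous_of_eval_smul {P : MvPolynomial τ ℂ} {n : ℕ}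
    (h : ∀ (c : ℂ) (y : τ → ℂ), eval (c • y) P = c ^ n * eval y P) : P.IsHomogeneous n := by
  have : P = homogeneousComponent n P := by
    refine MvPolynomial.funext fun y => ?_
    have h1 : restrictLine P y = Polynomial.monomial n (eval y P) :=
      Polynomial.funext fun c => by
        rw [restrictLine_eval, h, Polynomial.eval_monomial, mul_comm]
    rw [← restrictLine_coeff, h1, Polynomial.coeff_monomial, if_pos rfl]
  rw [this]
  exact homogeneousComponent_isHomogeneous n P

end Homogeneous

/-! ### Zariski topology and ideals of cones -/

section Zariski

variable {D r : ℕ}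

/-- The complement of the zero locus of `P`. -/
def basicOpen (P : MvPolynomial (Exponent D r) ℂ) : Set (Hypersurface D r) :=
  {F | eval F.coords P ≠ 0}

theorem isOpen_basicOpen {P : MvPolynomial (Exponent D r) ℂ} {n : ℕ} (hP : P.IsHomogeneous n) :
    IsOpen (basicOpen P) :=
  TopologicalSpace.isOpen_generateFrom_of_mem ⟨P, n, hP, rfl⟩

theorem isTopologicalBasis_basicOpen : TopologicalSpace.IsTopologicalBasis
    {U | ∃ (P : MvPolynomial (Exponent D r) ℂ) (n : ℕ), P.IsHomogeneous n ∧
      U = {F : Hypersurface D r | eval F.coords P ≠ 0}} where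
  exists_subset_inter := by
    rintro _ ⟨P, n, hP, rfl⟩ _ ⟨Q, k, hQ, rfl⟩ F ⟨hF1, hF2⟩
    refine ⟨_, ⟨P * Q, n + k, hP.mul hQ, rfl⟩, ?_, ?_⟩
    · simpa using ⟨hF1, hF2⟩
    · intro G hG
      simpa using hG
  sUnion_eq := Set.eq_univ_of_univ_subset fun F _ =>
    ⟨_, ⟨1, 0, isHomogeneous_one _ _, rfl⟩, by simp⟩
  eq_generateFrom := rfl

theorem exists_basicOpen_subset {U : Set (Hypersurface D r)} (hU : IsOpen U)
    {F : Hypersurface D r} (hF : F ∈ U) : ∃ (P : MvPolynomial (Exponent D r) ℂ) (n : ℕ),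
    P.IsHomogeneous n ∧ F ∈ basicOpen P ∧ basicOpen P ⊆ U := by
  obtain ⟨_, ⟨P, n, hP, rfl⟩, h1, h2⟩ := isTopologicalBasis_basicOpen.exists_subset_of_mem_open hF hU
  exact ⟨P, n, hP, h1, h2⟩

theorem eval_eq_zero_of_mem_closure {S : Set (Hypersurface D r)}
    {P : MvPolynomial (Exponent D r) ℂ} {n : ℕ} (hP : P.IsHomogeneous n)
    (h : ∀ G ∈ S, eval G.coords P = 0) {F : Hypersurface D r} (hF : F ∈ closure S) :
    eval F.coords P = 0 := by
  by_contra hne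
  obtain ⟨G, hG1, hG2⟩ := mem_closure_iff.1 hF _ (isOpen_basicOpen hP) hne
  exact hG1 (h G hG2)

theorem exists_of_notMem_closure {S : Set (Hypersurface D r)} {F : Hypersurface D r}
    (hF : F ∉ closure S) : ∃ (P : MvPolynomial (Exponent D r) ℂ) (n : ℕ), P.IsHomogeneous n ∧
      eval F.coords P ≠ 0 ∧ ∀ G ∈ S, eval G.coords P = 0 := by
  obtain ⟨P, n, hP, h1, h2⟩ := exists_basicOpen_subset isClosed_closure.isOpen_compl hF
  refine ⟨P, n, hP, h1, fun G hG => ?_⟩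
  by_contra hne
  exact h2 hne (subset_closure hG)

/-- The ideal of the polynomials which vanish on the cone over `S`. -/
noncomputable def coneIdeal (S : Set (Hypersurface D r)) : Ideal (MvPolynomial (Exponent D r) ℂ) where
  carrier := {P | ∀ F ∈ S, ∀ c : ℂ, eval (c • F.coords) P = 0}
  add_mem' hP hQ F hF c := by rw [map_add, hP F hF, hQ F hF, add_zero]
  zero_mem' F _ c := map_zero _
  smul_mem' P Q hQ F hF c := by rw [smul_eq_mul, map_mul, hQ F hF, mul_zero]

theorem mem_coneIdeal {S : Set (Hypersurface D r)} {P : MvPolynomial (Exponent D r) ℂ} :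
    P ∈ coneIdeal S ↔ ∀ F ∈ S, ∀ c : ℂ, eval (c • F.coords) P = 0 := Iff.rfl

theorem mem_coneIdeal_iff_homogeneousComponent {S : Set (Hypersurface D r)}
    {P : MvPolynomial (Exponent D r) ℂ} :
    P ∈ coneIdeal S ↔ ∀ F ∈ S, ∀ j, eval F.coords (homogeneousComponent j P) = 0 := by
  rw [mem_coneIdeal]
  refine forall₂_congr fun F _ => ?_
  rw [← restrictLine_eq_zero_iff, Polynomial.ext_iff]
  simp [restrictLine_coeff]

theorem mem_coneIdeal_of_isHomogeneous {S : Set (Hypersurface D r)}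
    {P : MvPolynomial (Exponent D r) ℂ} {n : ℕ} (hP : P.IsHomogeneous n) :
    P ∈ coneIdeal S ↔ ∀ F ∈ S, eval F.coords P = 0 := by
  rw [mem_coneIdeal]
  refine forall₂_congr fun F _ => ⟨fun h => by simpa using h 1, fun h c => ?_⟩
  rw [eval_smul_of_isHomogeneous hP, h, mul_zero]

theorem coneIdeal_anti {S T : Set (Hypersurface D r)} (h : S ⊆ T) : coneIdeal T ≤ coneIdeal S :=
  fun _ hP F hF => hP F (h hF)

theorem coneIdeal_closure (S : Set (Hypersurface D r)) : coneIdeal (closure S) = coneIdeal S := by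
  refine le_antisymm (coneIdeal_anti subset_closure) fun P hP => ?_
  rw [mem_coneIdeal_iff_homogeneousComponent] at hP ⊢
  exact fun F hF j => eval_eq_zero_of_mem_closure (homogeneousComponent_isHomogeneous j P)
    (fun G hG => hP G hG j) hF

theorem subset_closure_of_coneIdeal_le {S T : Set (Hypersurface D r)}
    (h : coneIdeal T ≤ coneIdeal S) : S ⊆ closure T := by
  intro F hF
  by_contra hne
  obtain ⟨P, n, hP, h1, h2⟩ := exists_of_notMem_closure hne
  exact h1 ((mem_coneIdeal_of_isHomogeneous hP).1
    (h ((mem_coneIdeal_of_isHomogeneous hP).2 h2)) F hF)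

/-- If neither factor vanishes on the cone, irreducibility gives one point where a homogeneous
component of each is nonzero; on the line through it, the two restrictions are nonzero univariate
polynomials with product zero. -/
theorem coneIdeal_isPrime {S : Set (Hypersurface D r)} (hS : IsIrreducible S) :
    (coneIdeal S).IsPrime where
  ne_top' := by
    intro h
    obtain ⟨F, hF⟩ := hS.nonempty
    have : (1 : MvPolynomial (Exponent D r) ℂ) ∈ coneIdeal S := h ▸ Submodule.mem_top
    simpa using this F hF 1
  mem_or_mem' := by
    intro P Q hPQ
    by_contra! hcon
    rw [mem_coneIdeal_iff_homogeneousComponent, mem_coneIdeal_iff_homogeneousComponent] at hcon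
    push Not at hcon
    obtain ⟨⟨F, hF, j, hj⟩, G, hG, k, hk⟩ := hcon
    obtain ⟨E, hE, hEj, hEk⟩ := hS.isPreirreducible _ _
      (isOpen_basicOpen (homogeneousComponent_isHomogeneous j P))
      (isOpen_basicOpen (homogeneousComponent_isHomogeneous k Q)) ⟨F, hF, hj⟩ ⟨G, hG, hk⟩
    have h1 : restrictLine P E.coords * restrictLine Q E.coords = 0 :=
      Polynomial.funext fun c => by
        rw [Polynomial.eval_mul, restrictLine_eval, restrictLine_eval, ← map_mul, hPQ E hE,
          Polynomial.eval_zero]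
    rcases mul_eq_zero.1 h1 with h | h
    · exact hEj (by rw [← restrictLine_coeff, h, Polynomial.coeff_zero])
    · exact hEk (by rw [← restrictLine_coeff, h, Polynomial.coeff_zero])

end Zariski

/-! ### Images of polynomial maps: irreducibility and the upper bound on dimension -/

section ImageSet

variable {D r : ℕ} {σ : Type} {Φ : Exponent D r → MvPolynomial σ ℂ}

theorem eval_aeval {τ : Type*} (Φ : τ → MvPolynomial σ ℂ) (P : MvPolynomial τ ℂ) (t : σ → ℂ) :
    eval t (aeval Φ P) = eval (fun m => eval t (Φ m)) P := by
  have : (eval t).comp (aeval (R := ℂ) Φ).toRingHom = eval fun m => eval t (Φ m) :=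
    MvPolynomial.ringHom_ext (fun c => by simp) (fun m => by simp)
  exact congrArg (fun f => f P) this

/-- The image in projective space of the polynomial map `Φ`. -/
def imageSet (Φ : Exponent D r → MvPolynomial σ ℂ) : Set (Hypersurface D r) :=
  {F | ∃ (t : σ → ℂ) (c : ℂ), c ≠ 0 ∧ F.coords = c • fun m => eval t (Φ m)}

theorem exists_mem_imageSet {t : σ → ℂ} {m : Exponent D r} (h : eval t (Φ m) ≠ 0) :
    ∃ F ∈ imageSet Φ, ∃ c : ℂ, c ≠ 0 ∧ F.coords = c • fun m => eval t (Φ m) := by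
  have hv : (coeffEquiv D r).symm (fun m => eval t (Φ m)) ≠ 0 := by
    rw [Ne, LinearEquiv.map_eq_zero_iff]
    exact fun h0 => h (congrFun h0 m)
  obtain ⟨c, hc, hF⟩ := Hypersurface.exists_coords_mk _ hv
  rw [LinearEquiv.apply_symm_apply] at hF
  exact ⟨_, ⟨t, c, hc, hF⟩, c, hc, hF⟩

theorem aeval_eq_zero_iff_of_isHomogeneous (hΦ : ∃ m, Φ m ≠ 0)
    {P : MvPolynomial (Exponent D r) ℂ} {n : ℕ} (hP : P.IsHomogeneous n) :
    aeval Φ P = 0 ↔ ∀ F ∈ imageSet Φ, eval F.coords P = 0 := by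
  constructor
  · rintro h F ⟨t, c, -, hF⟩
    rw [hF, eval_smul_of_isHomogeneous hP, ← eval_aeval, h, map_zero, mul_zero]
  · intro h
    obtain ⟨m, hm⟩ := hΦ
    have : aeval Φ P * Φ m = 0 := MvPolynomial.funext fun t => by
      rw [map_mul, map_zero]
      by_cases ht : eval t (Φ m) = 0
      · rw [ht, mul_zero]
      · obtain ⟨F, hF, c, hc, hFc⟩ := exists_mem_imageSet ht
        have := h F hF
        rw [hFc, eval_smul_of_isHomogeneous hP] at this
        rw [eval_aeval, (mul_eq_zero.1 this).resolve_left (pow_ne_zero _ hc), zero_mul]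
    exact (mul_eq_zero.1 this).resolve_right hm

/-- For maps homogeneous of positive degree the relations among the `Φ m` are exactly the equations
of the cone over the image, because that cone is itself in the image of the affine map. -/
theorem aeval_eq_zero_iff_mem_coneIdeal (hΦ : ∃ m, Φ m ≠ 0) {e : ℕ} (he : e ≠ 0)
    (hhom : ∀ m, (Φ m).IsHomogeneous e) {P : MvPolynomial (Exponent D r) ℂ} :
    aeval Φ P = 0 ↔ P ∈ coneIdeal (imageSet Φ) := by
  constructor
  · rintro h F ⟨t, c, -, hF⟩ b
    -- Rescaling the parameters by an `e`-th root realises any scalar multiple of the value.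
    obtain ⟨u, hu⟩ := IsAlgClosed.exists_pow_nat_eq (b * c) (Nat.pos_of_ne_zero he)
    have : b • F.coords = fun m => eval (u • t) (Φ m) := by
      ext m
      rw [eval_smul_of_isHomogeneous (hhom m), hu, hF]
      simp [mul_assoc]
    rw [this, ← eval_aeval, h, map_zero]
  · intro h
    rw [mem_coneIdeal_iff_homogeneousComponent] at h
    rw [← sum_homogeneousComponent P, map_sum]
    exact Finset.sum_eq_zero fun j _ => (aeval_eq_zero_iff_of_isHomogeneous hΦ
      (homogeneousComponent_isHomogeneous j P)).2 fun F hF => h F hF j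

theorem imageSet_isIrreducible (hΦ : ∃ m, Φ m ≠ 0) : IsIrreducible (imageSet Φ) := by
  obtain ⟨m, hm⟩ := id hΦ
  constructor
  · by_contra hempty
    rw [Set.not_nonempty_iff_eq_empty] at hempty
    apply hm
    refine MvPolynomial.funext fun t => ?_
    by_contra ht
    obtain ⟨F, hF, -⟩ := exists_mem_imageSet (D := D) (r := r) (Φ := Φ) (m := m)
      (by rwa [map_zero] at ht)
    rw [hempty] at hF
    exact hF
  · rintro u v hu hv ⟨F, hF, hFu⟩ ⟨G, hG, hGv⟩
    obtain ⟨P, n, hP, hPF, hPu⟩ := exists_basicOpen_subset hu hFu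
    obtain ⟨Q, k, hQ, hQG, hQv⟩ := exists_basicOpen_subset hv hGv
    have h1 : aeval Φ P ≠ 0 := fun h =>
      hPF ((aeval_eq_zero_iff_of_isHomogeneous hΦ hP).1 h F hF)
    have h2 : aeval Φ Q ≠ 0 := fun h =>
      hQG ((aeval_eq_zero_iff_of_isHomogeneous hΦ hQ).1 h G hG)
    have h3 : aeval Φ (P * Q) ≠ 0 := by rw [map_mul]; exact mul_ne_zero h1 h2
    rw [Ne, aeval_eq_zero_iff_of_isHomogeneous hΦ (hP.mul hQ)] at h3
    push Not at h3
    obtain ⟨E, hE, hE'⟩ := h3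
    rw [map_mul] at hE'
    exact ⟨E, hE, hPu (left_ne_zero_of_mul hE'), hQv (right_ne_zero_of_mul hE')⟩

theorem coneIdeal_lt_ker_constantCoeff {S : Set (Hypersurface D r)} (hS : S.Nonempty) :
    coneIdeal S < RingHom.ker (constantCoeff (R := ℂ) (σ := Exponent D r)) := by
  obtain ⟨F, hF⟩ := hS
  rw [SetLike.lt_iff_le_and_exists]
  refine ⟨fun P hP => ?_, ?_⟩
  · have := hP F hF 0
    rw [zero_smul, eval_zero] at this
    exact this
  · obtain ⟨m, hm⟩ := Function.ne_iff.1 F.coords_ne_zero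
    refine ⟨X m, by simp [RingHom.mem_ker], fun h => hm ?_⟩
    simpa using h F hF 1

theorem coneIdeal_image_lt {Z : Set (Hypersurface D r)}
    {S T : TopologicalSpace.IrreducibleCloseds Z} (h : S < T) :
    coneIdeal (Subtype.val '' (T : Set Z)) < coneIdeal (Subtype.val '' (S : Set Z)) := by
  refine lt_of_le_of_ne (coneIdeal_anti (Set.image_mono h.le)) fun heq => ?_
  refine h.not_ge fun x hx => ?_
  have h1 := subset_closure_of_coneIdeal_le heq.ge ⟨x, hx, rfl⟩
  have h2 : x ∈ closure (S : Set Z) := by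
    rwa [Topology.IsInducing.subtypeVal.closure_eq_preimage_closure_image]
  rwa [S.isClosed.closure_eq] at h2

/-- Cone ideals of irreducible closed sets are primes containing the relations. The ideal of the
origin contains all of them strictly and lengthens every chain by one, whence the `+ 1`. -/
theorem topologicalKrullDim_closure_imageSet_add_one_le [Fintype σ] (hΦ : ∃ m, Φ m ≠ 0) {e : ℕ}
    (he : e ≠ 0) (hhom : ∀ m, (Φ m).IsHomogeneous e) :
    topologicalKrullDim (closure (imageSet Φ)) + 1 ≤ Fintype.card σ := by
  set Z := closure (imageSet Φ)
  set K := RingHom.ker (aeval (R := ℂ) Φ)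
  have hirr : ∀ S : TopologicalSpace.IrreducibleCloseds Z,
      IsIrreducible (Subtype.val '' (S : Set Z)) :=
    fun S => S.isIrreducible.image _ continuous_subtype_val.continuousOn
  have hK : ∀ S : Set Z, K ≤ coneIdeal (Subtype.val '' S) := by
    intro S P hP
    have h1 : P ∈ coneIdeal Z := by
      rw [coneIdeal_closure]
      exact (aeval_eq_zero_iff_mem_coneIdeal hΦ he hhom).1 hP
    exact coneIdeal_anti (by rintro _ ⟨x, -, rfl⟩; exact x.2) h1
  have : Nonempty (TopologicalSpace.IrreducibleCloseds Z) := by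
    obtain ⟨F, hF⟩ := (imageSet_isIrreducible hΦ).nonempty
    exact ⟨⟨closure {⟨F, subset_closure hF⟩}, isIrreducible_singleton.closure, isClosed_closure⟩⟩
  -- The added bottom element goes to the ideal of the origin; inclusion of closed sets is reversed.
  let φ : WithBot (TopologicalSpace.IrreducibleCloseds Z) →
      (PrimeSpectrum.zeroLocus (R := MvPolynomial (Exponent D r) ℂ) K)ᵒᵈ := fun S =>
    match S with
    | none => OrderDual.toDual ⟨⟨RingHom.ker (constantCoeff (R := ℂ) (σ := Exponent D r)),
        RingHom.ker_isPrime _⟩, by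
          obtain ⟨S⟩ := this
          exact (hK S).trans (coneIdeal_lt_ker_constantCoeff (hirr S).nonempty).le⟩
    | some S => OrderDual.toDual ⟨⟨coneIdeal (Subtype.val '' (S : Set Z)),
        coneIdeal_isPrime (hirr S)⟩, hK S⟩
  have hφ : StrictMono φ := by
    intro S T hST
    induction T using WithBot.recBotCoe with
    | bot => exact absurd hST not_lt_bot
    | coe T =>
      induction S using WithBot.recBotCoe with
      | bot => exact coneIdeal_lt_ker_constantCoeff (hirr T).nonempty
      | coe S => exact coneIdeal_image_lt (WithBot.coe_lt_coe.1 hST)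
  have h1 := Order.krullDim_le_of_strictMono φ hφ
  rw [Order.krullDim_withBot, Order.krullDim_orderDual, ← ringKrullDim_quotient] at h1
  exact h1.trans (ringKrullDim_le_of_injective (Ideal.kerLiftAlg (aeval (R := ℂ) Φ))
    (Ideal.kerLiftAlg_injective _))

end ImageSet

/-! ### Coordinate flags and the lower bound on dimension -/

section Flag

variable {D r n : ℕ}

/-- Extension by zero from the first `k` coordinates. -/
noncomputable def truncate (k : ℕ) (P : MvPolynomial (Fin (n + 1)) ℂ) :
    MvPolynomial (Fin (k + 1)) ℂ :=
  aeval (fun i => if h : i.val < k + 1 then X ⟨i.val, h⟩ else 0) P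

def extendZero (k : ℕ) (t : Fin (k + 1) → ℂ) : Fin (n + 1) → ℂ :=
  fun i => if h : i.val < k + 1 then t ⟨i.val, h⟩ else 0

theorem eval_truncate (k : ℕ) (P : MvPolynomial (Fin (n + 1)) ℂ) (t : Fin (k + 1) → ℂ) :
    eval t (truncate k P) = eval (extendZero k t) P := by
  rw [truncate, eval_aeval]
  congr 2
  ext i
  rw [extendZero]
  split_ifs <;> simp

theorem extendZero_smul (k : ℕ) (c : ℂ) (t : Fin (k + 1) → ℂ) :
    (extendZero k (c • t) : Fin (n + 1) → ℂ) = c • extendZero k t := by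
  ext i
  simp only [extendZero, Pi.smul_apply]
  split_ifs <;> simp

theorem extendZero_extendZero {k l : ℕ} (hkl : k ≤ l) (t : Fin (k + 1) → ℂ) :
    (extendZero l (extendZero k t : Fin (l + 1) → ℂ) : Fin (n + 1) → ℂ) = extendZero k t := by
  ext i
  simp only [extendZero]
  split_ifs <;> first | rfl | omega

theorem truncate_isHomogeneous (k : ℕ) {P : MvPolynomial (Fin (n + 1)) ℂ} {e : ℕ}
    (hP : P.IsHomogeneous e) : (truncate k P).IsHomogeneous e :=
  isHomogeneous_of_eval_smul fun c t => by
    rw [eval_truncate, eval_truncate, extendZero_smul, eval_smul_of_isHomogeneous hP]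

theorem pderiv_truncate {k : ℕ} (hk : k ≤ n) (P : MvPolynomial (Fin (n + 1)) ℂ)
    (a : Fin (k + 1)) :
    pderiv a (truncate k P) = truncate k (pderiv (Fin.castLE (by omega) a) P) := by
  rw [truncate, pderiv_aeval, Finset.sum_eq_single (Fin.castLE (by omega) a)]
  · rw [dif_pos (by simp [Nat.le_of_lt_succ a.isLt]), truncate]
    simp
  · intro b _ hb
    split_ifs with h
    · rw [pderiv_X_of_ne, mul_zero]
      rintro rfl
      exact hb rfl
    · simp
  · simp

/-- The base point `Pi.single 0 1` lies in every subspace of the flag, and there the differential of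
the restricted map is the restriction of the differential. -/
theorem HasInjectiveDifferentialAt.truncate {τ : Type*} {Φ : τ → MvPolynomial (Fin (n + 1)) ℂ}
    {k : ℕ} (hk : k ≤ n) (h : HasInjectiveDifferentialAt Φ (Pi.single 0 1)) :
    HasInjectiveDifferentialAt (fun m => HessianMap.truncate k (Φ m)) (Pi.single 0 1) := by
  have h0 : (extendZero k (Pi.single 0 1) : Fin (n + 1) → ℂ) = Pi.single 0 1 := by
    ext i
    simp only [extendZero, Pi.single_apply, Fin.ext_iff]
    split_ifs <;> first | rfl | simp_all
  intro v hv
  have h1 := h (extendZero k v) fun m => by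
    rw [← hv m]
    symm
    refine Finset.sum_bij_ne_zero (fun a _ _ => Fin.castLE (by omega) a) (fun _ _ _ => Finset.mem_univ _)
      (fun a _ _ b _ _ hab => Fin.castLE_injective _ hab) (fun b _ hb => ?_) (fun a _ _ => ?_)
    · have hlt : b.val < k + 1 := by
        by_contra hlt
        simp [extendZero, hlt] at hb
      refine ⟨⟨b.val, hlt⟩, Finset.mem_univ _, ?_, rfl⟩
      rw [pderiv_truncate hk, eval_truncate, h0]
      simpa [extendZero, hlt] using hb
    · rw [pderiv_truncate hk, eval_truncate, h0]
      simp [extendZero, Nat.le_of_lt_succ a.isLt]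
  ext a
  have := congrFun h1 (Fin.castLE (by omega) a)
  simpa [extendZero, Nat.le_of_lt_succ a.isLt] using this

theorem HasInjectiveDifferentialAt.exists_ne_zero {τ : Type*} {Φ : τ → MvPolynomial (Fin (n + 1)) ℂ}
    {p : Fin (n + 1) → ℂ} (h : HasInjectiveDifferentialAt Φ p) : ∃ m, Φ m ≠ 0 := by
  by_contra! hcon
  have := h (Pi.single 0 1) fun m => by simp [hcon]
  simpa using congrFun this 0

theorem imageSet_truncate_subset {Φ : Exponent D r → MvPolynomial (Fin (n + 1)) ℂ} {k l : ℕ}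
    (hkl : k ≤ l) :
    imageSet (fun m => truncate k (Φ m)) ⊆ imageSet (fun m => truncate l (Φ m)) := by
  rintro F ⟨t, c, hc, hF⟩
  refine ⟨extendZero k t, c, hc, ?_⟩
  rw [hF]
  simp only [eval_truncate, extendZero_extendZero hkl]

theorem imageSet_truncate_subset_imageSet {Φ : Exponent D r → MvPolynomial (Fin (n + 1)) ℂ}
    (k : ℕ) : imageSet (fun m => truncate k (Φ m)) ⊆ imageSet Φ := by
  rintro F ⟨t, c, hc, hF⟩
  refine ⟨extendZero k t, c, hc, ?_⟩
  rw [hF]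
  simp only [eval_truncate]

/-- Some `l + 1` coordinates are algebraically independent on the larger image. Were it contained in
the closure of the smaller one, they would be independent there too, in a polynomial ring in only `k
+ 1` variables. -/
theorem not_imageSet_truncate_subset {Φ : Exponent D r → MvPolynomial (Fin (n + 1)) ℂ} {e : ℕ}
    (he : e ≠ 0) (hhom : ∀ m, (Φ m).IsHomogeneous e)
    (h : HasInjectiveDifferentialAt Φ (Pi.single 0 1)) {k l : ℕ} (hkl : k < l) (hl : l ≤ n) :
    ¬ imageSet (fun m => truncate l (Φ m)) ⊆ closure (imageSet (fun m => truncate k (Φ m))) := by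
  intro hsub
  obtain ⟨s, hs⟩ := (h.truncate hl).exists_algebraicIndependent
  have hdep : ¬ AlgebraicIndependent ℂ ((fun m => truncate k (Φ m)) ∘ s) := fun hind => by
    have := AlgebraicIndependent.card_le hind
    simp at this
    omega
  apply hdep
  rw [algebraicIndependent_iff] at hs ⊢
  intro P hP
  apply hs
  rw [← aeval_rename] at hP ⊢
  rw [aeval_eq_zero_iff_mem_coneIdeal (h.truncate (hkl.le.trans hl)).exists_ne_zero he
    (fun m => truncate_isHomogeneous k (hhom m)), ← coneIdeal_closure] at hP
  rw [aeval_eq_zero_iff_mem_coneIdeal (h.truncate hl).exists_ne_zero he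
    (fun m => truncate_isHomogeneous l (hhom m))]
  exact coneIdeal_anti hsub hP

theorem isPreirreducible_preimage_subtypeVal {X : Type*} [TopologicalSpace X] {Z C : Set X}
    (hCZ : C ⊆ Z) (hC : IsPreirreducible C) : IsPreirreducible ((↑) ⁻¹' C : Set Z) := by
  rintro _ _ ⟨u, hu, rfl⟩ ⟨v, hv, rfl⟩ ⟨x, hx, hxu⟩ ⟨y, hy, hyv⟩
  obtain ⟨z, hz, hzu, hzv⟩ := hC u v hu hv ⟨x, hx, hxu⟩ ⟨y, hy, hyv⟩
  exact ⟨⟨z, hCZ hz⟩, hz, hzu, hzv⟩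

theorem le_topologicalKrullDim_closure_imageSet
    {Φ : Exponent D r → MvPolynomial (Fin (n + 1)) ℂ} {e : ℕ}
    (he : e ≠ 0) (hhom : ∀ m, (Φ m).IsHomogeneous e)
    (h : HasInjectiveDifferentialAt Φ (Pi.single 0 1)) :
    (n : WithBot ℕ∞) ≤ topologicalKrullDim (closure (imageSet Φ)) := by
  let C : ℕ → Set (Hypersurface D r) := fun k => closure (imageSet fun m => truncate k (Φ m))
  have hCZ : ∀ k, C k ⊆ closure (imageSet Φ) :=
    fun k => closure_mono (imageSet_truncate_subset_imageSet k)
  have hirr : ∀ k ≤ n, IsIrreducible (C k) := fun k hk =>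
    (imageSet_isIrreducible (h.truncate hk).exists_ne_zero).closure
  let f : Fin (n + 1) → TopologicalSpace.IrreducibleCloseds (closure (imageSet Φ)) := fun k =>
    { carrier := (↑) ⁻¹' C k
      isIrreducible' := ⟨by
        obtain ⟨F, hF⟩ := (hirr k (by omega)).nonempty
        exact ⟨⟨F, hCZ k hF⟩, hF⟩,
        isPreirreducible_preimage_subtypeVal (hCZ k) (hirr k (by omega)).isPreirreducible⟩
      isClosed' := isClosed_closure.preimage continuous_subtype_val }
  have hf : StrictMono f := by
    intro k l hkl
    refine lt_of_le_not_ge (fun x hx => closure_mono (imageSet_truncate_subset hkl.le) hx)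
      fun hle => ?_
    refine not_imageSet_truncate_subset he hhom h (k := k) (l := l) hkl (by omega) fun F hF => ?_
    exact hle (show (⟨F, hCZ l (subset_closure hF)⟩ : closure (imageSet Φ)) ∈ f l from
      subset_closure hF)
  exact Order.LTSeries.length_le_krullDim (LTSeries.mk n f hf)

theorem topologicalKrullDim_closure_imageSet
    {Φ : Exponent D r → MvPolynomial (Fin (n + 1)) ℂ} {e : ℕ}
    (he : e ≠ 0) (hhom : ∀ m, (Φ m).IsHomogeneous e)
    (h : HasInjectiveDifferentialAt Φ (Pi.single 0 1)) :
    topologicalKrullDim (closure (imageSet Φ)) = n := by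
  refine le_antisymm ?_ (le_topologicalKrullDim_closure_imageSet he hhom h)
  have := topologicalKrullDim_closure_imageSet_add_one_le h.exists_ne_zero he hhom
  rw [Fintype.card_fin, ENat.WithBot.add_one_le_natCast_iff, Nat.cast_add, Nat.cast_one] at this
  exact ENat.WithBot.lt_add_one_iff.1 this

end Flag

/-! ### Generic finiteness of fibres -/

section Fibres

variable {D r : ℕ} {σ : Type} [Fintype σ]

/-- `V` is where, for every parameter, one chosen homogeneous component of a coefficient of its
algebraic equation is nonzero. The equations need not be homogeneous, so they are only guaranteed to
be nontrivial at a suitable multiple `μ` of the coordinates of `G`; there each parameter has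
finitely many values. -/
theorem exists_open_finite_fibres {Φ : Exponent D r → MvPolynomial σ ℂ} (hΦ : ∃ m, Φ m ≠ 0)
    {s : σ → Exponent D r} (h : AlgebraicIndependent ℂ (Φ ∘ s)) :
    ∃ V : Set (Hypersurface D r), IsOpen V ∧ (V ∩ imageSet Φ).Nonempty ∧
      ∀ G ∈ V, ∃ μ : ℂ, μ ≠ 0 ∧
        {t : σ → ℂ | (fun m => eval t (Φ m)) = μ • G.coords}.Finite := by
  choose Q k hk hroot using fun a => exists_algebraic_equation h a
  have hcomp : ∀ a, ∃ j, aeval Φ (homogeneousComponent j ((Q a).coeff (k a))) ≠ 0 := by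
    intro a
    by_contra! hcon
    apply hk a
    rw [← sum_homogeneousComponent ((Q a).coeff (k a)), map_sum]
    exact Finset.sum_eq_zero fun j _ => hcon j
  choose j hj using hcomp
  set P : MvPolynomial (Exponent D r) ℂ :=
    ∏ a, homogeneousComponent (j a) ((Q a).coeff (k a)) with hPdef
  have hP : P.IsHomogeneous (∑ a, j a) :=
    IsHomogeneous.prod _ _ _ fun a _ => homogeneousComponent_isHomogeneous _ _
  refine ⟨basicOpen P, isOpen_basicOpen hP, ?_, fun G hG => ?_⟩
  · have h1 : aeval Φ P ≠ 0 := by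
      rw [hPdef, map_prod]
      exact Finset.prod_ne_zero_iff.2 fun a _ => hj a
    rw [Ne, aeval_eq_zero_iff_of_isHomogeneous hΦ hP] at h1
    push Not at h1
    obtain ⟨F, hF, hF'⟩ := h1
    exact ⟨F, hF', hF⟩
  -- The extra factor `X` forces the chosen `μ` to be nonzero.
  · have h1 : (∏ a, restrictLine ((Q a).coeff (k a)) G.coords) * Polynomial.X ≠ 0 := by
      refine mul_ne_zero (Finset.prod_ne_zero_iff.2 fun a _ h0 => ?_) Polynomial.X_ne_zero
      have h2 : eval G.coords P ≠ 0 := hG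
      rw [hPdef, map_prod, Finset.prod_ne_zero_iff] at h2
      exact h2 a (Finset.mem_univ a) (by rw [← restrictLine_coeff, h0, Polynomial.coeff_zero])
    obtain ⟨μ, hμ⟩ : ∃ μ, Polynomial.eval μ
        ((∏ a, restrictLine ((Q a).coeff (k a)) G.coords) * Polynomial.X) ≠ 0 := by
      by_contra! hcon
      exact h1 (Polynomial.funext fun c => by rw [hcon, Polynomial.eval_zero])
    rw [Polynomial.eval_mul, Polynomial.eval_prod, Polynomial.eval_X] at hμ
    refine ⟨μ, right_ne_zero_of_mul hμ, ?_⟩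
    have h2 := Finset.prod_ne_zero_iff.1 (left_ne_zero_of_mul hμ)
    have hQ0 : ∀ a, (Q a).map (eval (μ • G.coords)) ≠ 0 := fun a h0 => by
      apply h2 a (Finset.mem_univ a)
      rw [restrictLine_eval, ← Polynomial.coeff_map, h0, Polynomial.coeff_zero]
    refine (Set.Finite.pi' fun a => (Polynomial.finite_setOfPred_isRoot (hQ0 a))).subset fun t ht a => ?_
    have := hroot a t
    rw [show (fun m => eval t (Φ m)) = μ • G.coords from ht] at this
    exact this

end Fibres

/-! ### Derivative of the Hessian determinant at the Waring form -/

section Differential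

theorem hasDerivAt_eval_line {ι : Type*} [Fintype ι] (P : MvPolynomial ι ℂ) (p v : ι → ℂ) :
    HasDerivAt (fun s : ℂ => eval (p + s • v) P) (∑ a, v a * eval p (pderiv a P)) 0 := by
  classical
  induction P using MvPolynomial.induction_on with
  | C c => simpa using hasDerivAt_const (0 : ℂ) c
  | add P Q hP hQ =>
    simp only [map_add, mul_add, Finset.sum_add_distrib]
    exact hP.add hQ
  | mul_X P k hP =>
    have h1 : HasDerivAt (fun s : ℂ => p k + s * v k) (v k) 0 := by
      simpa using ((hasDerivAt_id (0 : ℂ)).mul_const (v k)).const_add (p k)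
    have h2 := hP.mul h1
    simp only [map_mul, eval_X, Pi.add_apply, Pi.smul_apply, smul_eq_mul]
    refine h2.congr_deriv ?_
    have h3 : ∀ a, v a * eval p (pderiv a (P * X k)) = v a * eval p (pderiv a P) * p k +
        if a = k then eval p P * v a else 0 := by
      intro a
      rw [pderiv_mul, map_add, map_mul, map_mul, eval_X]
      split_ifs with hak
      · rw [hak, pderiv_X_self, map_one]; ring
      · rw [pderiv_X_of_ne (Ne.symm hak), map_zero]; ring
    rw [Finset.sum_congr rfl fun a _ => h3 a, Finset.sum_add_distrib,
      Finset.sum_ite_eq' Finset.univ k]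
    simp [Finset.sum_mul]

theorem hasDerivAt_det_one_add_smul {ι : Type*} [Fintype ι] [DecidableEq ι] (M : Matrix ι ι ℂ) :
    HasDerivAt (fun s : ℂ => (1 + s • M).det) M.trace 0 := by
  have h := (Matrix.det (1 + (Polynomial.X : Polynomial ℂ) • M.map Polynomial.C)).hasDerivAt 0
  rw [Matrix.derivative_det_one_add_X_smul] at h
  refine h.congr_of_eventuallyEq (Filter.Eventually.of_forall fun s => ?_)
  simp only
  rw [← Polynomial.coe_evalRingHom, RingHom.map_det]
  congr 1
  ext i j
  simp [Matrix.one_apply, apply_ite]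
  exact mul_comm _ _

/-- If `A * H` is a nonzero scalar matrix and the derivative of `det (H + s G)` at `s = 0` vanishes,
then `A * G` has trace zero. -/
theorem trace_mul_eq_zero {ι : Type*} [Fintype ι] [DecidableEq ι] {A H G : Matrix ι ι ℂ} {κ : ℂ}
    (hκ : κ ≠ 0) (hA : A * H = κ • 1) (h : HasDerivAt (fun s : ℂ => (H + s • G).det) 0 0) :
    (A * G).trace = 0 := by
  have h1 : HasDerivAt (fun s : ℂ => (1 + s • (κ⁻¹ • (A * G))).det) 0 0 := by
    have h2 := h.const_mul (κ⁻¹ • A).det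
    rw [mul_zero] at h2
    refine h2.congr_of_eventuallyEq (Filter.Eventually.of_forall fun s => ?_)
    simp only
    rw [← Matrix.det_mul, mul_add, Matrix.smul_mul, hA, smul_smul κ⁻¹ κ, inv_mul_cancel₀ hκ, one_smul,
      Matrix.smul_mul, Matrix.mul_smul, smul_comm]
  have h3 := (hasDerivAt_det_one_add_smul (κ⁻¹ • (A * G))).unique h1
  rw [Matrix.trace_smul, smul_eq_mul] at h3
  exact (mul_eq_zero.1 h3).resolve_left (inv_ne_zero hκ)

/-- With `H = diag h + u J`, the derivative of `det (H + s G)` is proportional to `tr (H⁻¹ G)`, and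
Sherman–Morrison gives `H⁻¹`. Grouping the result by `G i i + G j j - 2 G i j` produces the second
differences along `∂_i - ∂_j`. -/
theorem trace_identity {ι : Type*} [Fintype ι] [DecidableEq ι] {w h : ι → ℂ} {u : ℂ}
    {G : Matrix ι ι ℂ} (hw : ∀ i, w i * h i = 1) (hκ : 1 + u * ∑ i, w i ≠ 0)
    (hsymm : ∀ i j, G i j = G j i)
    (hder : HasDerivAt
      (fun s : ℂ => ((Matrix.diagonal h + Matrix.of fun _ _ => u) + s • G).det) 0 0) :
    2 * ∑ i, G i i * w i +
      u * ∑ i, ∑ j, (G i i + G j j - 2 * G i j) * (w i * w j) = 0 := by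
  set κ := 1 + u * ∑ i, w i with hκdef
  -- This is `κ` times the Sherman–Morrison inverse.
  let A : Matrix ι ι ℂ := κ • Matrix.diagonal w - Matrix.of fun i j => u * (w i * w j)
  have hA : A * (Matrix.diagonal h + Matrix.of fun _ _ => u) = κ • 1 := by
    ext i j
    simp only [A, Matrix.mul_apply, Matrix.sub_apply, Matrix.smul_apply, Matrix.add_apply,
      Matrix.of_apply, Matrix.diagonal_apply, Matrix.one_apply, smul_eq_mul, mul_add, sub_mul,
      Finset.sum_add_distrib, Finset.sum_sub_distrib]
    simp only [mul_ite, ite_mul, mul_zero, zero_mul, Finset.sum_ite_eq, Finset.sum_ite_eq',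
      Finset.mem_univ, if_true]
    have h1 : ∑ x, u * (w i * w x) * u = u * w i * (u * ∑ x, w x) := by
      rw [Finset.mul_sum, Finset.mul_sum]
      exact Finset.sum_congr rfl fun x _ => by ring
    rw [h1, show u * ∑ x, w x = κ - 1 by rw [hκdef]; ring]
    split_ifs with hij
    · subst hij
      linear_combination (κ - u * w i) * hw i
    · linear_combination (- u * w i) * hw j
  have ht := trace_mul_eq_zero hκ hA hder
  have ht' : κ * ∑ i, G i i * w i - u * ∑ i, ∑ j, G i j * (w i * w j) = 0 := by
    rw [← ht]
    simp only [A, Matrix.trace, Matrix.diag_apply, Matrix.mul_apply, Matrix.sub_apply,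
      Matrix.smul_apply, Matrix.of_apply, Matrix.diagonal_apply, smul_eq_mul, sub_mul,
      Finset.sum_sub_distrib, mul_ite, ite_mul, mul_zero, zero_mul, Finset.sum_ite_eq,
      Finset.mem_univ, if_true, Finset.mul_sum]
    congr 1
    · exact Finset.sum_congr rfl fun i _ => by ring
    · exact Finset.sum_congr rfl fun i _ => Finset.sum_congr rfl fun j _ => by
        rw [hsymm i j]; ring
  have h1 : ∑ i, ∑ j, G i i * (w i * w j) = (∑ i, G i i * w i) * ∑ j, w j := by
    rw [Finset.sum_mul_sum]
    exact Finset.sum_congr rfl fun i _ => Finset.sum_congr rfl fun j _ => by ring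
  have h2 : ∑ i, ∑ j, G j j * (w i * w j) = (∑ i, G i i * w i) * ∑ j, w j := by
    rw [Finset.sum_comm, ← h1]
    exact Finset.sum_congr rfl fun i _ => Finset.sum_congr rfl fun j _ => by ring
  have h3 : ∑ i, ∑ j, (G i i + G j j - 2 * G i j) * (w i * w j) =
      2 * ((∑ i, G i i * w i) * ∑ j, w j) - 2 * ∑ i, ∑ j, G i j * (w i * w j) := by
    simp only [add_mul, sub_mul, Finset.sum_add_distrib, Finset.sum_sub_distrib]
    rw [h1, h2]
    have : ∑ i, ∑ j, 2 * G i j * (w i * w j) = 2 * ∑ i, ∑ j, G i j * (w i * w j) := by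
      simp only [Finset.mul_sum, mul_assoc]
    rw [this]; ring
  rw [h3]
  rw [hκdef] at ht'
  linear_combination 2 * ht'

variable {r : ℕ} {σ : Type*} [Fintype σ] [DecidableEq σ]

/-- The form `∑ x_i ^ d + (∑ x_i) ^ d` of degree `d = e + 2`, normalised so that its Hessian matrix
is `diag (x_i ^ e) + (∑ x_i) ^ e • J`, where all the entries of `J` are `1`. -/
noncomputable def waringForm (e r : ℕ) : MvPolynomial (Fin (r + 1)) ℂ :=
  C ((((e + 2 : ℕ) : ℂ) * ((e + 1 : ℕ) : ℂ))⁻¹) * (∑ i, X i ^ (e + 2) + (∑ i, X i) ^ (e + 2))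

theorem waringForm_isHomogeneous (e r : ℕ) : (waringForm e r).IsHomogeneous (e + 2) := by
  have h1 : ((∑ i : Fin (r + 1), X i : MvPolynomial (Fin (r + 1)) ℂ) ^ (e + 2)).IsHomogeneous
      (e + 2) := by
    have := (IsHomogeneous.sum Finset.univ (fun i => (X i : MvPolynomial (Fin (r + 1)) ℂ)) 1
      fun a _ => isHomogeneous_X ℂ a).pow (e + 2)
    rwa [one_mul] at this
  have h2 : (∑ i : Fin (r + 1), (X i ^ (e + 2) : MvPolynomial (Fin (r + 1)) ℂ)).IsHomogeneous
      (e + 2) := IsHomogeneous.sum _ _ _ fun i _ => isHomogeneous_X_pow i _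
  rw [waringForm, ← zero_add (e + 2)]
  exact (isHomogeneous_C _ _).mul (by simpa only [zero_add] using h2.add h1)

omit [Fintype σ] [DecidableEq σ] in
theorem pderiv_natCast_mul (i : σ) (k : ℕ) (p : MvPolynomial σ ℂ) :
    pderiv i ((k : MvPolynomial σ ℂ) * p) = (k : MvPolynomial σ ℂ) * pderiv i p := by
  rw [← map_natCast (C (σ := σ) (R := ℂ)), pderiv_C_mul]

theorem pderiv_pderiv_sum_X_pow (e : ℕ) (i j : σ) :
    pderiv i (pderiv j (∑ a, X a ^ (e + 2) + (∑ a, X a) ^ (e + 2) : MvPolynomial σ ℂ)) =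
      ((e + 2 : ℕ) : MvPolynomial σ ℂ) * (((e + 1 : ℕ) : MvPolynomial σ ℂ) *
        ((if i = j then X i ^ e else 0) + (∑ a, X a) ^ e)) := by
  have h1 : pderiv j (∑ a, X a ^ (e + 2) : MvPolynomial σ ℂ) =
      ((e + 2 : ℕ) : MvPolynomial σ ℂ) * X j ^ (e + 1) := by
    rw [map_sum, Finset.sum_eq_single j]
    · exact pderiv_X_pow_self' j (e + 2)
    · intro b _ hb; exact pderiv_X_pow_of_ne hb _
    · simp
  have h2 : pderiv i (X j ^ (e + 1) : MvPolynomial σ ℂ) =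
      ((e + 1 : ℕ) : MvPolynomial σ ℂ) * if i = j then X i ^ e else 0 := by
    split_ifs with hij
    · subst hij; exact pderiv_X_pow_self' i (e + 1)
    · rw [pderiv_X_pow_of_ne (Ne.symm hij), mul_zero]
  have h3 := pderiv_sum_X_pow j (e + 2)
  have h4 := pderiv_sum_X_pow i (e + 1)
  rw [show e + 2 - 1 = e + 1 from rfl] at h3
  rw [show e + 1 - 1 = e from rfl] at h4
  rw [map_add, h1, h3, map_add, pderiv_natCast_mul, pderiv_natCast_mul, h2, h4, ← mul_add,
    ← mul_add]

theorem pderiv_pderiv_waringForm (e : ℕ) (i j : Fin (r + 1)) :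
    pderiv i (pderiv j (waringForm e r)) =
      (if i = j then X i ^ e else 0) + (∑ a, X a) ^ e := by
  have hne : (((e + 2 : ℕ) : ℂ) * ((e + 1 : ℕ) : ℂ)) ≠ 0 :=
    mul_ne_zero (Nat.cast_ne_zero.2 (by omega)) (Nat.cast_ne_zero.2 (by omega))
  rw [waringForm, pderiv_C_mul, pderiv_C_mul, pderiv_pderiv_sum_X_pow,
    ← map_natCast (C (σ := Fin (r + 1)) (R := ℂ)), ← map_natCast (C (σ := Fin (r + 1)) (R := ℂ)),
    ← mul_assoc, ← mul_assoc, mul_assoc (C _), ← C_mul, ← C_mul, inv_mul_cancel₀ hne, C_1, one_mul]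

theorem eval_hess_add_smul (f g : MvPolynomial (Fin (r + 1)) ℂ) (x : Fin (r + 1) → ℂ) (s : ℂ) :
    eval x (hess (f + s • g)) =
      ((Matrix.of fun i j => eval x (pderiv i (pderiv j f))) +
        s • Matrix.of fun i j => eval x (pderiv i (pderiv j g))).det := by
  rw [hess, RingHom.map_det]
  congr 1
  ext i j
  simp

/-- The trace identity divides by the `x_i^e` and by the Hessian determinant, so it is applied only
where these are nonzero; multiplying by them yields a polynomial identity, from which they are
cancelled. -/
theorem isInfinitesimallyTrivial_of_hasDerivAt {e : ℕ} {g : MvPolynomial (Fin (r + 1)) ℂ}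
    (h : ∀ x, HasDerivAt (fun s : ℂ => eval x (hess (waringForm e r + s • g))) 0 0) :
    IsInfinitesimallyTrivial e g := by
  set E : MvPolynomial (Fin (r + 1)) ℂ := 2 * ∑ i, pderiv i (pderiv i g) *
    ∏ k ∈ Finset.univ.erase i, X k ^ e +
    (∑ a, X a) ^ e * ∑ i, ∑ j ∈ Finset.univ.erase i,
      sqDiff g i j * ∏ k ∈ (Finset.univ.erase i).erase j, X k ^ e with hE
  -- This is the determinant `∏ x_k^e · (1 + l^e ∑ x_i^(-e))` of the Hessian matrix, denominators
  -- cleared; at the point `(1, …, 1)` it is positive.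
  let q : MvPolynomial (Fin (r + 1)) ℂ := ∏ k, X k ^ e + (∑ a, X a) ^ e *
    ∑ i, ∏ k ∈ Finset.univ.erase i, X k ^ e
  have hq : q ≠ 0 := by
    intro h0
    have := congrArg (eval fun _ => (1 : ℂ)) h0
    simp [q] at this
    norm_cast at this
    omega
  have hX : (∏ k : Fin (r + 1), X k : MvPolynomial (Fin (r + 1)) ℂ) ≠ 0 :=
    Finset.prod_ne_zero_iff.2 fun k _ => X_ne_zero k
  have hprod : E * (q * ∏ k, X k) = 0 := by
    refine MvPolynomial.funext fun x => ?_
    rw [map_mul, map_mul, map_zero]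
    by_cases hx : ∀ k, x k ≠ 0
    swap
    · push Not at hx
      obtain ⟨k, hk⟩ := hx
      rw [map_prod, Finset.prod_eq_zero (Finset.mem_univ k) (by rw [eval_X, hk]), mul_zero, mul_zero]
    by_cases hqx : eval x q = 0
    · rw [hqx, zero_mul, mul_zero]
    suffices eval x E = 0 by rw [this, zero_mul]
    have hpe : ∀ k, x k ^ e ≠ 0 := fun k => pow_ne_zero e (hx k)
    set B := ∏ k, x k ^ e with hB
    have hBi : ∀ i, ∏ k ∈ Finset.univ.erase i, x k ^ e = B * (x i ^ e)⁻¹ := by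
      intro i
      rw [eq_mul_inv_iff_mul_eq₀ (hpe i)]
      exact Finset.prod_erase_mul _ (fun k => x k ^ e) (Finset.mem_univ i)
    have hBij : ∀ i j, j ∈ Finset.univ.erase i →
        ∏ k ∈ (Finset.univ.erase i).erase j, x k ^ e = B * ((x i ^ e)⁻¹ * (x j ^ e)⁻¹) := by
      intro i j hj
      rw [← mul_assoc, ← hBi, eq_mul_inv_iff_mul_eq₀ (hpe j)]
      exact Finset.prod_erase_mul _ (fun k => x k ^ e) hj
    have hder := h x
    simp only [eval_hess_add_smul, pderiv_pderiv_waringForm] at hder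
    have hid := trace_identity (w := fun i => (x i ^ e)⁻¹) (h := fun i => x i ^ e)
      (u := (∑ a, x a) ^ e) (G := Matrix.of fun i j => eval x (pderiv i (pderiv j g)))
      (fun i => inv_mul_cancel₀ (hpe i)) ?_ (fun i j => by
        simp only [Matrix.of_apply]; rw [pderiv_comm]) ?_
    · simp only [Matrix.of_apply] at hid
      have h1 : ∀ i, ∑ j ∈ Finset.univ.erase i, eval x (sqDiff g i j) *
          ∏ k ∈ (Finset.univ.erase i).erase j, x k ^ e =
          B * ∑ j, (eval x (pderiv i (pderiv i g)) + eval x (pderiv j (pderiv j g)) -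
            2 * eval x (pderiv i (pderiv j g))) * ((x i ^ e)⁻¹ * (x j ^ e)⁻¹) := by
        intro i
        rw [← Finset.add_sum_erase _ _ (Finset.mem_univ i), mul_add, Finset.mul_sum]
        rw [show ∀ a b : ℂ, a + a - 2 * a = 0 from fun a _ => by ring, zero_mul, mul_zero, zero_add]
        · refine Finset.sum_congr rfl fun j hj => ?_
          rw [hBij i j hj, sqDiff]
          simp only [map_sub, map_add, map_mul, map_ofNat]
          ring
        · exact 0
      rw [hE]
      simp only [map_add, map_mul, map_sum, map_prod, map_pow, eval_X, map_ofNat, hBi, h1]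
      rw [← Finset.mul_sum]
      have h2 : ∑ i, eval x (pderiv i (pderiv i g)) * (B * (x i ^ e)⁻¹) =
          B * ∑ i, eval x (pderiv i (pderiv i g)) * (x i ^ e)⁻¹ := by
        rw [Finset.mul_sum]
        exact Finset.sum_congr rfl fun i _ => by ring
      rw [h2]
      linear_combination B * hid
    · intro h0
      apply hqx
      simp only [q, map_add, map_mul, map_sum, map_prod, map_pow, eval_X, hBi]
      rw [← Finset.mul_sum]
      linear_combination B * h0
    · convert hder using 4
      ext i j
      simp only [Matrix.add_apply, Matrix.of_apply, Matrix.diagonal_apply, map_add, map_pow, map_sum,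
        eval_X, apply_ite (eval x), map_zero]
  exact (mul_eq_zero.1 hprod).resolve_right (mul_ne_zero hq hX)

end Differential

/-! ### Coefficients of the Hessian as polynomials in parameters -/

section HessianCoefficients

variable {r : ℕ} {ι : Type} [Fintype ι] [DecidableEq ι]

/-- The coefficients of the Hessian of the form `T t`, as polynomials in `t`. -/
noncomputable def hessCoeff (T : (ι → ℂ) →ₗ[ℂ] MvPolynomial (Fin (r + 1)) ℂ)
    (m : Fin (r + 1) →₀ ℕ) : MvPolynomial ι ℂ :=
  coeff m (Matrix.of fun i j : Fin (r + 1) => pderiv i (pderiv j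
    (∑ a, C (X a) * map (C (σ := ι)) (T (Pi.single a 1))))).det

theorem eval_hessCoeff (T : (ι → ℂ) →ₗ[ℂ] MvPolynomial (Fin (r + 1)) ℂ)
    (m : Fin (r + 1) →₀ ℕ) (t : ι → ℂ) : eval t (hessCoeff T m) = coeff m (hess (T t)) := by
  have hT : map (eval t) (∑ a, C (X a) * map (C (σ := ι)) (T (Pi.single a 1))) = T t := by
    conv_rhs => rw [← Finset.univ_sum_single t]
    rw [map_sum, map_sum]
    refine Finset.sum_congr rfl fun a _ => ?_
    have h1 : (eval t).comp (C (σ := ι)) = RingHom.id ℂ := by ext; simp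
    have h2 : (Pi.single a (t a) : ι → ℂ) = t a • Pi.single a 1 := by
      rw [← Pi.single_smul, smul_eq_mul, mul_one]
    rw [map_mul, map_C, eval_X, map_map, h1, map_id, h2, map_smul, smul_eq_C_mul]
  rw [hessCoeff, ← coeff_map, RingHom.map_det, hess]
  congr 2
  ext1 i j
  simp only [RingHom.mapMatrix_apply, Matrix.map_apply, Matrix.of_apply, ← pderiv_map, hT]

theorem hess_smul (c : ℂ) (f : MvPolynomial (Fin (r + 1)) ℂ) :
    hess (c • f) = c ^ (r + 1) • hess f := by
  have : (Matrix.of fun i j : Fin (r + 1) => pderiv i (pderiv j (c • f))) =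
      (C c : MvPolynomial (Fin (r + 1)) ℂ) • Matrix.of fun i j : Fin (r + 1) => pderiv i (pderiv j f) := by
    ext1 i j
    simp [smul_eq_C_mul]
  rw [hess, this, Matrix.det_smul, hess, Fintype.card_fin, smul_eq_C_mul, C_pow]

theorem hessCoeff_isHomogeneous (T : (ι → ℂ) →ₗ[ℂ] MvPolynomial (Fin (r + 1)) ℂ)
    (m : Fin (r + 1) →₀ ℕ) : (hessCoeff T m).IsHomogeneous (r + 1) :=
  isHomogeneous_of_eval_smul fun c t => by
    rw [eval_hessCoeff, eval_hessCoeff, map_smul, hess_smul, coeff_smul, smul_eq_mul]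

end HessianCoefficients

/-! ### The Hessian map in linear parameters -/

section Parametrisation

variable {d r n : ℕ}

theorem card_exponent_eq (d r : ℕ) : Fintype.card (Exponent d r) = N d r + 1 := by
  rw [card_exponent, N]
  have : 0 < (d + r).choose d := Nat.choose_pos (by omega)
  omega

/-- The flag argument needs the point of injectivity to be the first basis vector; the
parametrisation is chosen so that `v` sits there. -/
theorem exists_linearEquiv_apply_single (d r : ℕ) {v : homogeneousSubmodule (Fin (r + 1)) ℂ d}
    (hv : v ≠ 0) : ∃ T : (Fin (N d r + 1) → ℂ) ≃ₗ[ℂ] homogeneousSubmodule (Fin (r + 1)) ℂ d,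
      T (Pi.single 0 1) = v := by
  let S : (Fin (N d r + 1) → ℂ) ≃ₗ[ℂ] homogeneousSubmodule (Fin (r + 1)) ℂ d :=
    (LinearEquiv.funCongrLeft ℂ ℂ (Fintype.equivFinOfCardEq (card_exponent_eq d r))).trans
      (coeffEquiv d r).symm
  have h1 : (Pi.single 0 1 : Fin (N d r + 1) → ℂ) ≠ 0 := by simp
  have h2 : S.symm v ≠ 0 := by rwa [Ne, LinearEquiv.map_eq_zero_iff]
  obtain ⟨A, hA⟩ := SeparatingDual.exists_continuousLinearEquiv_apply_eq (R := ℂ) h1 h2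
  refine ⟨A.toLinearEquiv.trans S, ?_⟩
  simp [hA]

/-- The coefficients of the form `T t`, as polynomials in `t`. -/
noncomputable def formCoeff (T : (Fin (n + 1) → ℂ) ≃ₗ[ℂ] homogeneousSubmodule (Fin (r + 1)) ℂ d)
    (m : Exponent d r) : MvPolynomial (Fin (n + 1)) ℂ :=
  ∑ a, C (coeffEquiv d r (T (Pi.single a 1)) m) * X a

theorem sum_mul_coeffEquiv_single
    (T : (Fin (n + 1) → ℂ) ≃ₗ[ℂ] homogeneousSubmodule (Fin (r + 1)) ℂ d) (m : Exponent d r)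
    (t : Fin (n + 1) → ℂ) :
    ∑ a, t a * coeffEquiv d r (T (Pi.single a 1)) m = coeffEquiv d r (T t) m := by
  conv_rhs => rw [← Finset.univ_sum_single t]
  rw [map_sum, map_sum, Finset.sum_apply]
  refine Finset.sum_congr rfl fun a _ => ?_
  have h2 : (Pi.single a (t a) : Fin (n + 1) → ℂ) = t a • Pi.single a 1 := by
    rw [← Pi.single_smul, smul_eq_mul, mul_one]
  rw [h2, map_smul, map_smul, Pi.smul_apply, smul_eq_mul]

theorem eval_formCoeff (T : (Fin (n + 1) → ℂ) ≃ₗ[ℂ] homogeneousSubmodule (Fin (r + 1)) ℂ d)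
    (m : Exponent d r) (t : Fin (n + 1) → ℂ) :
    eval t (formCoeff T m) = coeffEquiv d r (T t) m := by
  rw [← sum_mul_coeffEquiv_single, formCoeff, map_sum]
  exact Finset.sum_congr rfl fun a _ => by rw [map_mul, eval_C, eval_X, mul_comm]

theorem formCoeff_isHomogeneous
    (T : (Fin (n + 1) → ℂ) ≃ₗ[ℂ] homogeneousSubmodule (Fin (r + 1)) ℂ d) (m : Exponent d r) :
    (formCoeff T m).IsHomogeneous 1 :=
  isHomogeneous_of_eval_smul fun c t => by
    rw [eval_formCoeff, eval_formCoeff, map_smul, map_smul, Pi.smul_apply, smul_eq_mul, pow_one]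

theorem formCoeff_hasInjectiveDifferentialAt
    (T : (Fin (n + 1) → ℂ) ≃ₗ[ℂ] homogeneousSubmodule (Fin (r + 1)) ℂ d) (p : Fin (n + 1) → ℂ) :
    HasInjectiveDifferentialAt (formCoeff T) p := by
  intro v hv
  have h1 : ∀ m a, pderiv a (formCoeff T m) = C (coeffEquiv d r (T (Pi.single a 1)) m) := by
    intro m a
    rw [formCoeff, map_sum, Finset.sum_eq_single a]
    · rw [pderiv_C_mul, pderiv_X_self, mul_one]
    · intro b _ hb
      rw [pderiv_C_mul, pderiv_X_of_ne hb, mul_zero]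
    · simp
  have h2 : coeffEquiv d r (T v) = 0 := by
    ext m
    have := hv m
    simp only [h1, eval_C] at this
    rw [← sum_mul_coeffEquiv_single, this, Pi.zero_apply]
  rwa [LinearEquiv.map_eq_zero_iff, LinearEquiv.map_eq_zero_iff] at h2

theorem imageSet_formCoeff
    (T : (Fin (n + 1) → ℂ) ≃ₗ[ℂ] homogeneousSubmodule (Fin (r + 1)) ℂ d) :
    imageSet (formCoeff T) = Set.univ := by
  refine Set.eq_univ_of_univ_subset fun F _ => ?_
  refine ⟨T.symm ((coeffEquiv d r).symm F.coords), 1, one_ne_zero, ?_⟩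
  ext m
  simp [eval_formCoeff]

/-- The linear map underlying a parametrisation of the space of forms. -/
noncomputable def formMap (T : (Fin (n + 1) → ℂ) ≃ₗ[ℂ] homogeneousSubmodule (Fin (r + 1)) ℂ d) :
    (Fin (n + 1) → ℂ) →ₗ[ℂ] MvPolynomial (Fin (r + 1)) ℂ :=
  (homogeneousSubmodule (Fin (r + 1)) ℂ d).subtype ∘ₗ T.toLinearMap

/-- The coefficients of the Hessian of `T t`, as polynomials in `t`. -/
noncomputable def hessianCoords
    (T : (Fin (n + 1) → ℂ) ≃ₗ[ℂ] homogeneousSubmodule (Fin (r + 1)) ℂ d)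
    (m : Exponent ((r + 1) * (d - 2)) r) : MvPolynomial (Fin (n + 1)) ℂ :=
  hessCoeff (formMap T) m.1

theorem eval_hessianCoords (T : (Fin (n + 1) → ℂ) ≃ₗ[ℂ] homogeneousSubmodule (Fin (r + 1)) ℂ d)
    (m : Exponent ((r + 1) * (d - 2)) r) (t : Fin (n + 1) → ℂ) :
    eval t (hessianCoords T m) = coeff m.1 (hess (T t).1) :=
  eval_hessCoeff _ _ _

theorem eq_sum_coeff_of_isHomogeneous {D : ℕ} {p : MvPolynomial (Fin (r + 1)) ℂ}
    (hp : p.IsHomogeneous D) : p = ∑ m : Exponent D r, monomial m.1 (coeff m.1 p) :=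
  (congrArg Subtype.val ((coeffEquiv D r).symm_apply_apply ⟨p, hp⟩)).symm

/-- A kernel vector `v` kills the derivative of every Hessian coefficient, hence of every value of
the Hessian along `w + s • T v`; the linearised problem then gives `T v = 0`. -/
theorem hessianCoords_hasInjectiveDifferentialAt {e : ℕ} (he : e ≠ 0) (hr : 2 ≤ r)
    (T : (Fin (n + 1) → ℂ) ≃ₗ[ℂ] homogeneousSubmodule (Fin (r + 1)) ℂ (e + 2))
    {p : Fin (n + 1) → ℂ} (hp : (T p).1 = waringForm e r) :
    HasInjectiveDifferentialAt (hessianCoords T) p := by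
  intro v hv
  have h1 : ∀ x : Fin (r + 1) → ℂ,
      HasDerivAt (fun s : ℂ => eval x (hess (waringForm e r + s • (T v).1))) 0 0 := by
    intro x
    have h2 : ∀ m, HasDerivAt (fun s : ℂ => eval (p + s • v) (hessianCoords T m) *
        eval x (monomial m.1 1)) 0 0 := fun m => by
      have := (hasDerivAt_eval_line (hessianCoords T m) p v).mul_const (eval x (monomial m.1 1))
      rwa [hv m, zero_mul] at this
    have h3 := HasDerivAt.fun_sum (u := Finset.univ) fun m _ => h2 m
    rw [Finset.sum_const_zero] at h3
    refine h3.congr_of_eventuallyEq (Filter.Eventually.of_forall fun s => ?_)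
    have h4 : (T (p + s • v)).1 = waringForm e r + s • (T v).1 := by
      rw [map_add, map_smul, ← hp]; rfl
    have h5 : (hess (T (p + s • v)).1).IsHomogeneous ((r + 1) * (e + 2 - 2)) :=
      hess_isHomogeneous (T (p + s • v)).2
    simp only
    rw [← h4]
    conv_lhs => rw [eq_sum_coeff_of_isHomogeneous h5]
    rw [map_sum]
    refine Finset.sum_congr rfl fun m _ => ?_
    rw [eval_hessianCoords, ← mul_one (coeff _ _), ← C_mul_monomial, map_mul, eval_C, mul_one]
  have h3 : ∀ i j : Fin (r + 1), ∃ k, k ≠ i ∧ k ≠ j := by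
    intro i j
    have : ({i, j} : Finset (Fin (r + 1))).card < (Finset.univ : Finset (Fin (r + 1))).card := by
      rw [Finset.card_univ, Fintype.card_fin]
      exact Finset.card_le_two.trans_lt (by omega)
    obtain ⟨k, -, hk⟩ := Finset.exists_mem_notMem_of_card_lt_card this
    exact ⟨k, by simpa [not_or] using hk⟩
  have h4 : (T v).1 = 0 := eq_zero_of_isInfinitesimallyTrivial he h3 (T v).2
    (isInfinitesimallyTrivial_of_hasDerivAt h1)
  rw [← T.map_eq_zero_iff]
  exact Subtype.ext h4

theorem hess_equation_eq (T : (Fin (n + 1) → ℂ) ≃ₗ[ℂ] homogeneousSubmodule (Fin (r + 1)) ℂ d)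
    {F : Hypersurface d r} {t : Fin (n + 1) → ℂ} {a : ℂ} (h : F.coords = a • coeffEquiv d r (T t)) :
    hess F.equation = a ^ (r + 1) • hess (T t).1 := by
  rw [F.coords_eq, ← map_smul] at h
  rw [← hess_smul, Hypersurface.equation, (coeffEquiv d r).injective h]
  rfl

theorem exists_coords_hessianMap (F : definedLocus d r) : ∃ c : ℂ, c ≠ 0 ∧
    (hessianMap d r F).coords = c • fun m => coeff m.1 (hess F.1.equation) :=
  Hypersurface.exists_coords_mk _ _

theorem range_hessianMap (T : (Fin (n + 1) → ℂ) ≃ₗ[ℂ] homogeneousSubmodule (Fin (r + 1)) ℂ d) :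
    Set.range (hessianMap d r) = imageSet (hessianCoords T) := by
  ext G
  constructor
  · rintro ⟨F, rfl⟩
    obtain ⟨c, hc, h⟩ := exists_coords_hessianMap F
    refine ⟨T.symm (Projectivization.rep F.1), c, hc, ?_⟩
    rw [h]
    congr 1
    ext m
    rw [eval_hessianCoords, LinearEquiv.apply_symm_apply]
    rfl
  · rintro ⟨t, c, hc, hG⟩
    have hhess : hess (T t).1 ≠ 0 := by
      intro h0
      apply G.coords_ne_zero
      rw [hG]
      ext m
      simp [eval_hessianCoords, h0]
    have hT : T t ≠ 0 := by
      intro h0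
      apply hhess
      have := hess_smul (r := r) 0 0
      rw [zero_pow (by omega), zero_smul, zero_smul] at this
      rw [h0]
      exact this
    obtain ⟨a, ha, hF⟩ := Hypersurface.exists_coords_mk (T t) hT
    have h1 := hess_equation_eq T hF
    have hmem : Hypersurface.mk (T t) hT ∈ definedLocus d r := by
      rw [definedLocus, Set.mem_ofPred_eq, h1]
      exact smul_ne_zero (pow_ne_zero _ ha) hhess
    refine ⟨⟨_, hmem⟩, ?_⟩
    symm
    refine Hypersurface.eq_mk_of_coords_eq (c := c * (a ^ (r + 1))⁻¹) _ ?_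
    rw [hG]
    ext m
    have h2 : coeff m.1 (hess (T t).1) = (a ^ (r + 1))⁻¹ *
        coeff m.1 (hess (Hypersurface.mk (T t) hT).equation) := by
      rw [h1, coeff_smul, smul_eq_mul, inv_mul_cancel_left₀ (pow_ne_zero _ ha)]
    rw [Pi.smul_apply, eval_hessianCoords, h2, Pi.smul_apply, smul_eq_mul, smul_eq_mul, mul_assoc]
    rfl

/-- Substituting the inverse of `T` expresses the Hessian coefficients through the homogeneous
coordinates of `F`, which exhibits the locus as a union of basic open sets. -/
theorem definedLocus_eq (T : (Fin (n + 1) → ℂ) ≃ₗ[ℂ] homogeneousSubmodule (Fin (r + 1)) ℂ d) :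
    definedLocus d r = ⋃ m, {F : Hypersurface d r |
      eval F.coords (aeval (fun a => (∑ i, C ((T.symm ((coeffEquiv d r).symm (Pi.single i 1))) a) *
        X i : MvPolynomial (Exponent d r) ℂ)) (hessianCoords T m)) ≠ 0} := by
  classical
  ext F
  have h1 : ∀ m, eval F.coords (aeval (fun a => (∑ i, C ((T.symm ((coeffEquiv d r).symm
      (Pi.single i 1))) a) * X i : MvPolynomial (Exponent d r) ℂ)) (hessianCoords T m)) =
      coeff m.1 (hess F.equation) := by
    intro m
    rw [eval_aeval]
    have : (fun a => eval F.coords (∑ i, C ((T.symm ((coeffEquiv d r).symm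
        (Pi.single i 1))) a) * X i : MvPolynomial (Exponent d r) ℂ)) =
        T.symm (Projectivization.rep F) := by
      ext a
      have h2 : (Projectivization.rep F : homogeneousSubmodule (Fin (r + 1)) ℂ d) =
          ∑ i, F.coords i • (coeffEquiv d r).symm (Pi.single i 1) := by
        apply (coeffEquiv d r).injective
        rw [← F.coords_eq, map_sum]
        simp only [map_smul, LinearEquiv.apply_symm_apply]
        ext m
        simp [Finset.sum_apply, Pi.single_apply]
      rw [h2, map_sum, map_sum, Finset.sum_apply]
      refine Finset.sum_congr rfl fun i _ => ?_
      rw [map_smul, Pi.smul_apply, map_mul, eval_C, eval_X, smul_eq_mul, mul_comm]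
    rw [this, eval_hessianCoords, LinearEquiv.apply_symm_apply]
    rfl
  simp only [Set.mem_iUnion, Set.mem_ofPred_eq, h1]
  rw [definedLocus, Set.mem_ofPred_eq, ← not_iff_not]
  push Not
  constructor
  · intro h m
    rw [h, coeff_zero]
  · intro h
    rw [eq_sum_coeff_of_isHomogeneous (hess_isHomogeneous F.equation_isHomogeneous)]
    exact Finset.sum_eq_zero fun m _ => by rw [h m, monomial_zero]

theorem isOpen_definedLocus
    (T : (Fin (n + 1) → ℂ) ≃ₗ[ℂ] homogeneousSubmodule (Fin (r + 1)) ℂ d) :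
    IsOpen (definedLocus d r) := by
  rw [definedLocus_eq T]
  refine isOpen_iUnion fun m => isOpen_basicOpen (n := 1 * (r + 1)) ?_
  refine (hessCoeff_isHomogeneous _ _).aeval _ fun a => ?_
  refine IsHomogeneous.sum _ _ _ fun i _ => ?_
  simpa using (isHomogeneous_C _ _).mul (isHomogeneous_X ℂ i)

/-- Each hypersurface in the fibre has an equation whose Hessian has coefficient vector exactly `μ •
G.coords`; as the parameters of that equation determine the hypersurface, finiteness descends from
the affine fibre. -/
theorem finite_fibre (T : (Fin (n + 1) → ℂ) ≃ₗ[ℂ] homogeneousSubmodule (Fin (r + 1)) ℂ d)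
    {G : Hypersurface ((r + 1) * (d - 2)) r} {μ : ℂ} (hμ : μ ≠ 0)
    (h : {t | (fun m => eval t (hessianCoords T m)) = μ • G.coords}.Finite) :
    (hessianMap d r ⁻¹' {G}).Finite := by
  have key : ∀ F : definedLocus d r, ∃ t, F ∈ hessianMap d r ⁻¹' {G} →
      ((fun m => eval t (hessianCoords T m)) = μ • G.coords ∧
        ∃ a : ℂ, F.1.coords = a • coeffEquiv d r (T t)) := by
    intro F
    by_cases hF : F ∈ hessianMap d r ⁻¹' {G}
    swap
    · exact ⟨0, fun h => absurd h hF⟩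
    obtain ⟨c, hc, hcF⟩ := exists_coords_hessianMap F
    rw [show hessianMap d r F = G from hF] at hcF
    -- Scaling `f` by `u` scales `hess f` by `u^(r+1)`.
    obtain ⟨u, hu⟩ := IsAlgClosed.exists_pow_nat_eq (μ * c) (Nat.succ_pos r)
    have hu0 : u ≠ 0 := by
      rintro rfl
      rw [zero_pow (by omega)] at hu
      exact mul_ne_zero hμ hc hu.symm
    refine ⟨u • T.symm (Projectivization.rep F.1), fun _ => ⟨?_, u⁻¹, ?_⟩⟩
    · ext m
      rw [eval_hessianCoords, map_smul, LinearEquiv.apply_symm_apply, hcF]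
      have : ((u • Projectivization.rep F.1 : homogeneousSubmodule (Fin (r + 1)) ℂ d) :
          MvPolynomial (Fin (r + 1)) ℂ) = u • F.1.equation := rfl
      rw [this, hess_smul, coeff_smul, hu, smul_smul]
      rfl
    · rw [map_smul, LinearEquiv.apply_symm_apply, map_smul, smul_smul, inv_mul_cancel₀ hu0,
        one_smul]
      rfl
  choose t ht using key
  refine Set.Finite.of_injOn (f := t) (fun F hF => (ht F hF).1) (fun F hF F' hF' heq => ?_) h
  obtain ⟨a, ha⟩ := (ht F hF).2
  obtain ⟨a', ha'⟩ := (ht F' hF').2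
  have hT : T (t F) ≠ 0 := by
    intro h0
    apply F.1.coords_ne_zero
    rw [ha, h0, map_zero, smul_zero]
  rw [← heq] at ha'
  exact Subtype.ext ((Hypersurface.eq_mk_of_coords_eq hT ha).trans
    (Hypersurface.eq_mk_of_coords_eq hT ha').symm)

end Parametrisation

end HessianMap

theorem mainTheorem5 (d r : ℕ) (hd : 3 ≤ d) (hr : 2 ≤ r) :
    (IsOpen (HessianMap.definedLocus d r) ∧ Dense (HessianMap.definedLocus d r)) ∧
    HessianMap.IsGenericallyFiniteOntoImage d r ∧
    topologicalKrullDim (HessianMap.hessianVariety d r) = (HessianMap.N d r : WithBot ℕ∞) ∧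
    topologicalKrullDim (HessianMap.Hypersurface d r) = (HessianMap.N d r : WithBot ℕ∞) := by
  obtain ⟨e, rfl⟩ : ∃ e, d = e + 2 := ⟨d - 2, by omega⟩
  have he : e ≠ 0 := by omega
  have hw : (⟨HessianMap.waringForm e r, HessianMap.waringForm_isHomogeneous e r⟩ :
      homogeneousSubmodule (Fin (r + 1)) ℂ (e + 2)) ≠ 0 := by
    intro h
    -- The mixed derivative `∂_0 ∂_1` of the Waring form is `(∑ x_a)^e`, which is nonzero.
    have h1 := HessianMap.pderiv_pderiv_waringForm (r := r) e 0 1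
    rw [show HessianMap.waringForm e r = 0 from congrArg Subtype.val h, map_zero, map_zero,
      if_neg (by simp [Fin.ext_iff]; omega), zero_add] at h1
    exact pow_ne_zero e HessianMap.sum_X_ne_zero h1.symm
  obtain ⟨T, hT⟩ := HessianMap.exists_linearEquiv_apply_single (e + 2) r hw
  have hinj : HessianMap.HasInjectiveDifferentialAt (HessianMap.hessianCoords T)
      (Pi.single 0 1) :=
    HessianMap.hessianCoords_hasInjectiveDifferentialAt he hr T (by rw [hT])
  have hhom : ∀ m, (HessianMap.hessianCoords T m).IsHomogeneous (r + 1) :=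
    fun m => HessianMap.hessCoeff_isHomogeneous _ _
  have hinj' := HessianMap.formCoeff_hasInjectiveDifferentialAt T (Pi.single 0 1)
  have huniv := HessianMap.imageSet_formCoeff T
  have hrange := HessianMap.range_hessianMap T
  have hvar : HessianMap.hessianVariety (e + 2) r =
      closure (HessianMap.imageSet (HessianMap.hessianCoords T)) := by
    rw [HessianMap.hessianVariety, hrange]
  have hopen := HessianMap.isOpen_definedLocus T
  refine ⟨⟨hopen, ?_⟩, ?_, ?_, ?_⟩
  · have hirr := HessianMap.imageSet_isIrreducible hinj'.exists_ne_zero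
    rw [huniv] at hirr
    have : PreirreducibleSpace (HessianMap.Hypersurface (e + 2) r) := ⟨hirr.isPreirreducible⟩
    refine hopen.dense ?_
    obtain ⟨F, hF⟩ := (HessianMap.imageSet_isIrreducible hinj.exists_ne_zero).nonempty
    rw [← hrange] at hF
    obtain ⟨E, -⟩ := hF
    exact ⟨E.1, E.2⟩
  · obtain ⟨s, hs⟩ := hinj.exists_algebraicIndependent
    obtain ⟨V, hV, ⟨F, hFV, hF⟩, hfin⟩ :=
      HessianMap.exists_open_finite_fibres hinj.exists_ne_zero hs
    have hirr : IsIrreducible (HessianMap.hessianVariety (e + 2) r) := by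
      rw [hvar]
      exact (HessianMap.imageSet_isIrreducible hinj.exists_ne_zero).closure
    have := Subtype.preirreducibleSpace hirr.isPreirreducible
    have hVopen : IsOpen ((↑) ⁻¹' V : Set (HessianMap.hessianVariety (e + 2) r)) :=
      hV.preimage continuous_subtype_val
    refine ⟨_, hVopen, hVopen.dense ⟨⟨F, ?_⟩, hFV⟩, fun G hG => ?_⟩
    · rw [hvar]
      exact subset_closure hF
    · obtain ⟨μ, hμ, hμfin⟩ := hfin G.1 hG
      exact HessianMap.finite_fibre T hμ hμfin
  · rw [hvar]
    exact HessianMap.topologicalKrullDim_closure_imageSet (Nat.succ_ne_zero r) hhom hinj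
  -- `Σ(d,r)` is itself the image of a linear map with injective differential.
  · rw [← HessianMap.topologicalKrullDim_closure_imageSet one_ne_zero
      (HessianMap.formCoeff_isHomogeneous T) hinj', huniv, closure_univ]
    exact ((Homeomorph.Set.univ _).isHomeomorph.topologicalKrullDim_eq _).symm
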